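/- Let $\mathcal X$ and $\mathcal A$ be separable metrizable spaces with their Borel $\sigma$-algebras, such that $|\mathcal A|\ge 2$ and there is a non-atomic probability measure on $\mathcal X$, i.e. a Borel probability measure $\nu$ with $\nu(\{x\})=0$ for all $x\in\mathcal X$. A process is a stochastic process $\mathbb X=(X_t)_{t\ge1}$ with values in $\mathcal X$ (identified with its law). * $\mathcal C_2$ is the set of processes such that for every sequence $(B_k)_{k}$ of pairwise disjoint measurable subsets of $\mathcal X$, almost surely, $|\{k:\{X_1,\dots,X_T\}\cap B_k\neq\emptyset\}|=o(T)$ as $T\to\infty$. * For $i\ge 0$ and $k=u2^i+v$ with $u\ge0$, $0\le v<2^i$, let $T_i^k=\lfloor 2^u(1+v2^{-i})\rfloor$, and let $\mathcal T^i$ be the (random) set of times $t\ge1$ such that, for the $k$ with $T_i^k\le t<T_i^{k+1}$, $X_{t'}\ne X_t$ for all $T_i^k\le t'<t$. $\mathcal C_4$ is the set of processes such that for every sequence $(B_i)_{i}$ of pairwise disjoint measurable subsets of $\mathcal X$, $$\lim_{i\to\infty}\mathbb E\Big[\limsup_{T\to\infty}\frac1T\sum_{t\le T,\,t\in\mathcal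 T^i}\mathbf 1_{B_i}(X_t)\Big]=0 .$$ * A learning rule is a sequence of measurable, possibly randomized, functions $f_t:\mathcal X^{t-1}\times[0,1]^{t-1}\times\mathcal X\to\mathcal A$, where the randomization is through a random seed that is independent of the contexts and of the reward noise and may be shared by all rounds; it selects $\hat a_t=f_t((X_s)_{s<t},(r_s)_{s<t},X_t)$, where $r_s$ is the reward received in round $s$. An oblivious reward mechanism is given by conditional distributions $P_{r\mid a,x,t}$ on $[0,1]$ ($t\ge1$): the potential reward $r_t(a\mid x)$ of round $t$ for action $a$ and context $x$ has law $P_{r\mid a,x,t}$, depends measurably on $(a,x)$ and a noise variable of round $t$, and the noise variables are independent over $t$ and independent of $\mathbb X$ and of the seed; we write $r_t(a)=r_t(a\mid X_t)$, and the reward received in round $t$ is $r_t=r_t(\hat a_t)$. The rule is consistent under $\mathbb X$ with these rewards if for every measurable $\pi:\mathcal X\to\mathcal A$, $$\limsup_{T\to\infty}\frac1T\sum_{t=1}^T\big(r_t(\pi(X_t))-r_t(\hat a_t)\big)\le0\quad\text{almost surely.}$$ $\mathcal C_{\mathrm{oblivious}}$ is the set of processes $\mathbb X$ for which there is a learning rule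 that is consistent under $\mathbb X$ with every oblivious reward mechanism. Then $\mathcal C_4\subsetneq\mathcal C_2$ and $\mathcal C_{\mathrm{oblivious}}\subsetneq\mathcal C_2$. -/

import Mathlib

open MeasureTheory ProbabilityTheory Filter Topology
open scoped ENNReal unitInterval

universe u v w

namespace ContextualBandit

noncomputable section

/-- A stochastic process `(X_t)_{t ≥ 1}` on `𝓧`, given by its law on the sequence space.
Sequences are indexed from `0`: the coordinate `x t` of a path is the context `X_{t+1}`. -/
abbrev ContextProcess (𝓧 : Type u) [MeasurableSpace 𝓧] : Type u :=
  ProbabilityMeasure (ℕ → 𝓧)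

/-! ### The conditions `C₂` and `C₄` -/

/-- `|{k : {X_1, …, X_T} ∩ B_k ≠ ∅}|`. -/
def visitedCount {𝓧 : Type u} (B : ℕ → Set 𝓧) (x : ℕ → 𝓧) (T : ℕ) : ℕ :=
  Set.ncard {k : ℕ | ∃ t < T, x t ∈ B k}

/-- The class `C₂`: almost surely, the process visits a sublinear number of members of any
sequence of disjoint measurable sets. -/
def C2 (𝓧 : Type u) [MeasurableSpace 𝓧] : Set (ContextProcess 𝓧) :=
  {μ | ∀ B : ℕ → Set 𝓧, (∀ k, MeasurableSet (B k)) → Pairwise (Function.onFun Disjoint B) →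
    ∀ᵐ x ∂(μ : Measure (ℕ → 𝓧)),
      (fun T : ℕ => (visitedCount B x T : ℝ)) =o[atTop] (fun T : ℕ => (T : ℝ))}

/-- `T_i^k = ⌊2^u (1 + v 2^{-i})⌋` where `k = u 2^i + v`, `0 ≤ v < 2^i`. -/
def scaleTime (i k : ℕ) : ℕ :=
  ⌊(2 : ℝ) ^ (k / 2 ^ i) * (1 + ((k % 2 ^ i : ℕ) : ℝ) / (2 : ℝ) ^ i)⌋₊

/-- The set `𝒯^i` of times at which the context appears for the first time within its period
`[T_i^k, T_i^{k+1})`. The element `t` of this set stands for the time `t + 1`. -/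
def firstTimes {𝓧 : Type u} (i : ℕ) (x : ℕ → 𝓧) : Set ℕ :=
  {t | ∃ k : ℕ, scaleTime i k ≤ t + 1 ∧ t + 1 < scaleTime i (k + 1) ∧
    ∀ s < t, scaleTime i k ≤ s + 1 → x s ≠ x t}

/-- `limsup_T (1/T) ∑_{t ≤ T, t ∈ 𝒯^i} 1_B(X_t)`, as an element of `[0, ∞]`. -/
def scaleFreq {𝓧 : Type u} (i : ℕ) (B : Set 𝓧) (x : ℕ → 𝓧) : ℝ≥0∞ :=
  limsup (fun T : ℕ =>
    (∑ t ∈ Finset.range T,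
      Set.indicator {t : ℕ | t ∈ firstTimes i x ∧ x t ∈ B} (fun _ => (1 : ℝ≥0∞)) t) / (T : ℝ≥0∞))
    atTop

/-- The class `C₄`: for disjoint measurable `(B_i)`, the expectation
`E[limsup_T (1/T) ∑_{t ≤ T, t ∈ 𝒯^i} 1_{B_i}(X_t)]` tends to `0` as `i → ∞`. -/
def C4 (𝓧 : Type u) [MeasurableSpace 𝓧] : Set (ContextProcess 𝓧) :=
  {μ | ∀ B : ℕ → Set 𝓧, (∀ i, MeasurableSet (B i)) → Pairwise (Function.onFun Disjoint B) →
    Tendsto (fun i : ℕ => ∫⁻ x, scaleFreq i (B i) x ∂(μ : Measure (ℕ → 𝓧))) atTop (𝓝 0)}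

/-! ### Learning rules, oblivious rewards, consistency -/

/-- A (possibly randomized) learning rule: `act t s x r y` is the action chosen in round `t + 1`
from the random seed `s`, the `t` past contexts `x`, the `t` past received rewards `r` (with values
in `[0,1]`) and the current context `y`. The seed is drawn once and is available in all rounds, so
the rule may use arbitrarily correlated randomization and can recompute its own past actions. -/
structure LearningRule (𝓧 : Type u) (A : Type v) [MeasurableSpace 𝓧] [MeasurableSpace A] where
  /-- The space in which the seed lives. -/
  Seed : Type w
  /-- Its σ-algebra. -/
  [measurableSeed : MeasurableSpace Seed]
  /-- The law of the seed. -/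
  seedLaw : Measure Seed
  /-- The law of the seed is a probability measure. -/
  [isProb : IsProbabilityMeasure seedLaw]
  /-- The action selected. -/
  act : (t : ℕ) → Seed → (Fin t → 𝓧) → (Fin t → I) → 𝓧 → A
  /-- The selection is jointly measurable. -/
  measurable_act : ∀ t, Measurable
    (fun z : Seed × (Fin t → 𝓧) × (Fin t → I) × 𝓧 => act t z.1 z.2.1 z.2.2.1 z.2.2.2)

attribute [instance] LearningRule.measurableSeed LearningRule.isProb

/-- An oblivious reward mechanism with rewards in `[0,1]`: conditional distributions
`P_{r ∣ a, x, t}`, realized by measurable potential rewards `r_t(a ∣ x)` which are functions of a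
uniform variable `U_t`; the `U_t` will be independent across rounds and independent of everything
else. The joint law over `a` of the potential rewards of one round is not restricted. -/
structure ObliviousReward (𝓧 : Type u) (A : Type v) [MeasurableSpace 𝓧] [MeasurableSpace A] where
  /-- The conditional distribution of the reward of each round given action and context. -/
  dist : ℕ → Kernel (A × 𝓧) I
  /-- The potential reward `r_t(a ∣ x)` as a function of the noise `U_t`, of `a` and of `x`. -/
  reward : ℕ → I → A → 𝓧 → I
  /-- The potential rewards are jointly measurable. -/
  measurable_reward : ∀ t, Measurable (fun z : I × A × 𝓧 => reward t z.1 z.2.1 z.2.2)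
  /-- `r_t(a ∣ x)` has the prescribed law. -/
  map_reward : ∀ t a x, (volume : Measure I).map (fun u => reward t u a x) = dist t (a, x)

/-- Every sequence of conditional distributions is realized by an oblivious reward mechanism. -/
theorem ObliviousReward.exists_dist_eq {𝓧 : Type u} {A : Type v} [MeasurableSpace 𝓧]
    [MeasurableSpace A] (P : ℕ → Kernel (A × 𝓧) I) [∀ t, IsMarkovKernel (P t)] :
    ∃ R : ObliviousReward 𝓧 A, R.dist = P := by
  have h := fun t => Kernel.exists_measurable_map_eq_unitInterval (P t)
  choose f hf hmap using h
  refine ⟨⟨P, fun t u a x => f t (a, x) u, fun t => ?_, fun t a x => hmap t (a, x)⟩, rfl⟩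
  exact (hf t).comp (Measurable.prodMk measurable_snd measurable_fst)

section Interaction

variable {𝓧 : Type u} {A : Type v} [MeasurableSpace 𝓧] [MeasurableSpace A]

/-- The rewards received in the first `t` rounds, when the seed of the rule is `s`, the contexts
are `x` and the noise of the rewards is `n`. -/
def received (f : LearningRule.{u, v, w} 𝓧 A) (R : ObliviousReward 𝓧 A)
    (s : f.Seed) (x : ℕ → 𝓧) (n : ℕ → I) : (t : ℕ) → Fin t → I
  | 0 => Fin.elim0
  | t + 1 =>
    Fin.snoc (received f R s x n t)
      (R.reward t (n t)
        (f.act t s (fun j : Fin t => x j) (received f R s x n t) (x t)) (x t))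

/-- The action selected by the rule in round `t + 1`. -/
def action (f : LearningRule.{u, v, w} 𝓧 A) (R : ObliviousReward 𝓧 A)
    (s : f.Seed) (x : ℕ → 𝓧) (n : ℕ → I) (t : ℕ) : A :=
  f.act t s (fun j : Fin t => x j) (received f R s x n t) (x t)

/-- The average regret `(1/T) ∑_{t ≤ T} (r_t(π(X_t)) - r_t(â_t))` against the policy `π`. -/
def avgRegret (f : LearningRule.{u, v, w} 𝓧 A) (R : ObliviousReward 𝓧 A) (π : 𝓧 → A)
    (s : f.Seed) (x : ℕ → 𝓧) (n : ℕ → I) (T : ℕ) : ℝ :=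
  (1 / (T : ℝ)) * ∑ t ∈ Finset.range T,
    ((R.reward t (n t) (π (x t)) (x t) : ℝ) -
      (R.reward t (n t) (action f R s x n t) (x t) : ℝ))

/-- The rule `f` is consistent under the process `μ` with rewards `R`: almost surely, the average
regret against any measurable policy has nonpositive limit superior. Contexts, seed and reward
noise are independent. -/
def IsConsistent (μ : ContextProcess 𝓧) (R : ObliviousReward 𝓧 A) (f : LearningRule.{u, v, w} 𝓧 A) :
    Prop :=
  ∀ π : 𝓧 → A, Measurable π →
    ∀ᵐ z ∂((μ : Measure (ℕ → 𝓧)).prod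
        (f.seedLaw.prod (Measure.infinitePi fun _ : ℕ => (volume : Measure I)))),
      limsup (fun T : ℕ => avgRegret f R π z.2.1 z.1 z.2.2 T) atTop ≤ 0

end Interaction

/-- The class `C_oblivious` of processes under which some learning rule is consistent with all
oblivious rewards. -/
def COblivious (𝓧 : Type u) (A : Type v) [MeasurableSpace 𝓧] [MeasurableSpace A] :
    Set (ContextProcess 𝓧) :=
  {μ | ∃ f : LearningRule.{u, v, w} 𝓧 A, ∀ R : ObliviousReward 𝓧 A, IsConsistent μ R f}

end

end ContextualBandit

/-!
A process outside of `C₂` visits, with probability bounded from below and at arbitrarily late times,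
linearly many members of some disjoint family (`exists_frequent_visits_of_notMem_C2`). Grouping
consecutive members into blocks, and distributing the blocks so that each scale gets infinitely many
of them, contradicts `C₄` (`C4_subset_C2`). Attaching an unknown fair bit to each member, which
decides whether action `a₁` or the other actions are rewarded there, forces every rule to err with
probability one half at every first visit; so no rule is consistent for all sequences of bits
(`COblivious_subset_C2`).

Both inclusions are strict because of one process. The times `2 ^ u ≤ τ < 2 ^ (u + 1)` form window
`u`, and each window has a type `i` such that every type occurs infinitely often. A window of type
`i` consists of `2 ^ i` cycles through the same contexts, which are drawn afresh for the window, one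
from each of `2 ^ (u - i)` cells. The cells have equal measure under a non-atomic probability
measure `ν` and divide a set `block i`, and the blocks are disjoint (`CellSystem`,
`CellSystem.process`).

* The number of distinct draws which hit a set of small `ν`-measure is small, by Chebyshev's
  inequality and the Borel–Cantelli lemma, and the tail of a disjoint family has small measure. So
  the process is in `C₂` (`CellSystem.process_mem_C2`).
* In a window of type `i` the cycles are the periods of scale `i`, so all its times belong to
  `firstTimes i`, and its contexts are in `block i`. So the process is not in `C₄`
  (`CellSystem.process_notMem_C4`).
* Suppose that some rule is consistent for all oblivious rewards. In a window, let a safe action pay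
  `3 / 4`, while all other actions are risky: for a certain number of cycles they pay `1` on a
  random half of the cells, the target, and they pay `0` otherwise. The rule does not see when the
  payments will stop. A first risky play in a cell has mean payoff `1 / 2`, so if payments stop with
  the cycle in which many cells are tried for the first time, the rule falls behind the safe action.
  Hence for some number of paying cycles the rule has positive regret with respect to the safe
  action, at a rate that depends only on `i`, or it tries few cells and has regret with respect to
  playing a risky action on the target, at a rate that does not depend on `i`
  (`window_alternative`). For fixed `i` the former cannot happen in all late windows, as the windows
  in which it happens could be combined (`exists_unexplored_window`). So the latter happens for
  every `i`, and as the blocks are disjoint, one policy is right about the targets of all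
  types. The rule is not consistent with respect to this policy (`notMem_COblivious`).
-/

namespace ContextualBandit

/-! ### Expectations of sequences with nonpositive limit superior -/

/-- A form of the reverse Fatou lemma; it follows by applying dominated convergence to the positive
parts, which tend to `0`. -/
theorem eventually_integral_le_of_ae_eventually_le {Ω : Type*} [MeasurableSpace Ω]
    {P : Measure Ω} [IsProbabilityMeasure P] {f : ℕ → Ω → ℝ} (hm : ∀ n, Measurable (f n))
    (hb : ∀ n ω, |f n ω| ≤ 1) (h : ∀ δ > 0, ∀ᵐ ω ∂P, ∀ᶠ n in atTop, f n ω ≤ δ)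
    {δ : ℝ} (hδ : 0 < δ) : ∀ᶠ n in atTop, ∫ ω, f n ω ∂P ≤ δ := by
  have hlim : Tendsto (fun n => ∫ ω, max (f n ω) 0 ∂P) atTop (𝓝 (∫ _, (0 : ℝ) ∂P)) := by
    refine tendsto_integral_of_dominated_convergence (fun _ => 1)
      (fun n => ((hm n).max measurable_const).aestronglyMeasurable) (integrable_const 1)
      (fun n => ae_of_all _ fun ω => ?_) ?_
    · rw [Real.norm_eq_abs, abs_of_nonneg (le_max_right _ _)]
      exact max_le ((le_abs_self _).trans (hb n ω)) zero_le_one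
    · have h' : ∀ᵐ ω ∂P, ∀ k : ℕ, ∀ᶠ n in atTop, f n ω ≤ 1 / ((k : ℝ) + 1) :=
        ae_all_iff.2 fun k => h _ Nat.one_div_pos_of_nat
      filter_upwards [h'] with ω hω
      rw [Metric.tendsto_atTop']
      intro ε hε
      obtain ⟨k, hk⟩ := exists_nat_one_div_lt hε
      obtain ⟨N, hN⟩ := eventually_atTop.1 (hω k)
      refine ⟨N, fun n hn => ?_⟩
      rw [Real.dist_eq, sub_zero, abs_of_nonneg (le_max_right _ _)]
      exact max_lt ((hN n hn.le).trans_lt hk) hε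
  rw [integral_zero] at hlim
  filter_upwards [hlim.eventually (gt_mem_nhds hδ)] with n hn
  refine le_trans (integral_mono ?_ ?_ fun ω => le_max_left _ _) hn.le
  · exact Integrable.of_bound (hm n).aestronglyMeasurable 1 (ae_of_all _ (hb n))
  · refine Integrable.of_bound ((hm n).max measurable_const).aestronglyMeasurable 1
      (ae_of_all _ fun ω => ?_)
    rw [Real.norm_eq_abs, abs_of_nonneg (le_max_right _ _)]
    exact max_le ((le_abs_self _).trans (hb n ω)) zero_le_one

/-! ### The interaction of a learning rule with rewards -/

section Interaction

variable {𝓧 : Type u} {A : Type v} [MeasurableSpace 𝓧] [MeasurableSpace A]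

/-- The history of received rewards depends on the reward mechanism only through the rewards of
the actions that were actually selected. -/
theorem received_congr (f : LearningRule.{u, v, w} 𝓧 A) {R R' : ObliviousReward 𝓧 A}
    (s : f.Seed) (x : ℕ → 𝓧) (n : ℕ → I) (t : ℕ)
    (h : ∀ j < t, R.reward j (n j) (action f R s x n j) (x j) =
      R'.reward j (n j) (action f R s x n j) (x j)) :
    received f R s x n t = received f R' s x n t := by
  induction t with
  | zero => rfl
  | succ t ih =>
    have h1 := ih fun j hj => h j (hj.trans (Nat.lt_succ_self t))
    have h2 := h t (Nat.lt_succ_self t)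
    unfold action at h2
    simp only [received]
    rw [h2, ← h1]

theorem action_congr (f : LearningRule.{u, v, w} 𝓧 A) {R R' : ObliviousReward 𝓧 A}
    (s : f.Seed) (x : ℕ → 𝓧) (n : ℕ → I) (t : ℕ)
    (h : ∀ j < t, R.reward j (n j) (action f R s x n j) (x j) =
      R'.reward j (n j) (action f R s x n j) (x j)) :
    action f R s x n t = action f R' s x n t := by
  unfold action
  rw [received_congr f s x n t h]

variable {Θ : Type*} [MeasurableSpace Θ]

/-- Received rewards are jointly measurable in the seed, the contexts, the noise, and a parameter
of the reward mechanism. -/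
theorem measurable_received (f : LearningRule.{u, v, w} 𝓧 A) (R : Θ → ObliviousReward 𝓧 A)
    (hR : ∀ t, Measurable fun z : Θ × I × A × 𝓧 => (R z.1).reward t z.2.1 z.2.2.1 z.2.2.2)
    (t : ℕ) :
    Measurable fun z : Θ × (ℕ → 𝓧) × f.Seed × (ℕ → I) =>
      received f (R z.1) z.2.2.1 z.2.1 z.2.2.2 t := by
  induction t with
  | zero => exact measurable_const
  | succ t ih =>
    refine measurable_pi_iff.2 fun j => ?_
    induction j using Fin.lastCases with
    | cast j =>
      simpa only [received, Fin.snoc_castSucc, Function.comp_def] using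
        (measurable_pi_apply j).comp ih
    | last =>
      simp only [received, Fin.snoc_last]
      have hx : Measurable fun z : Θ × (ℕ → 𝓧) × f.Seed × (ℕ → I) => z.2.1 t :=
        (measurable_pi_apply t).comp (measurable_fst.comp measurable_snd)
      have ha : Measurable fun z : Θ × (ℕ → 𝓧) × f.Seed × (ℕ → I) =>
          f.act t z.2.2.1 (fun j : Fin t => z.2.1 j) (received f (R z.1) z.2.2.1 z.2.1 z.2.2.2 t)
            (z.2.1 t) := by
        refine (f.measurable_act t).comp (Measurable.prodMk (by fun_prop) (Measurable.prodMk ?_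
          (ih.prodMk hx)))
        exact measurable_pi_iff.2 fun j =>
          (measurable_pi_apply (j : ℕ)).comp (measurable_fst.comp measurable_snd)
      refine (hR t).comp (measurable_fst.prodMk (Measurable.prodMk ?_ (ha.prodMk hx)))
      exact (measurable_pi_apply t).comp (by fun_prop)

theorem measurable_action (f : LearningRule.{u, v, w} 𝓧 A) (R : Θ → ObliviousReward 𝓧 A)
    (hR : ∀ t, Measurable fun z : Θ × I × A × 𝓧 => (R z.1).reward t z.2.1 z.2.2.1 z.2.2.2)
    (t : ℕ) :
    Measurable fun z : Θ × (ℕ → 𝓧) × f.Seed × (ℕ → I) =>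
      action f (R z.1) z.2.2.1 z.2.1 z.2.2.2 t := by
  refine (f.measurable_act t).comp (Measurable.prodMk (by fun_prop) (Measurable.prodMk ?_
    ((measurable_received f R hR t).prodMk ?_)))
  · exact measurable_pi_iff.2 fun j =>
      (measurable_pi_apply (j : ℕ)).comp (measurable_fst.comp measurable_snd)
  · exact (measurable_pi_apply t).comp (measurable_fst.comp measurable_snd)

theorem measurable_avgRegret (f : LearningRule.{u, v, w} 𝓧 A) (R : Θ → ObliviousReward 𝓧 A)
    (hR : ∀ t, Measurable fun z : Θ × I × A × 𝓧 => (R z.1).reward t z.2.1 z.2.2.1 z.2.2.2)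
    (π : Θ → 𝓧 → A) (hπ : Measurable fun z : Θ × 𝓧 => π z.1 z.2) (T : ℕ) :
    Measurable fun z : Θ × (ℕ → 𝓧) × f.Seed × (ℕ → I) =>
      avgRegret f (R z.1) (π z.1) z.2.2.1 z.2.1 z.2.2.2 T := by
  unfold avgRegret
  refine Measurable.const_mul (Finset.measurable_sum _ fun t _ => ?_) _
  have hx : Measurable fun z : Θ × (ℕ → 𝓧) × f.Seed × (ℕ → I) => z.2.1 t :=
    (measurable_pi_apply t).comp (measurable_fst.comp measurable_snd)
  have hn : Measurable fun z : Θ × (ℕ → 𝓧) × f.Seed × (ℕ → I) => z.2.2.2 t :=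
    (measurable_pi_apply t).comp (by fun_prop)
  refine Measurable.sub (measurable_subtype_coe.comp ?_) (measurable_subtype_coe.comp ?_)
  · exact (hR t).comp (measurable_fst.prodMk (hn.prodMk
      ((hπ.comp (measurable_fst.prodMk hx)).prodMk hx)))
  · exact (hR t).comp (measurable_fst.prodMk (hn.prodMk
      ((measurable_action f R hR t).prodMk hx)))

theorem abs_avgRegret_le_one (f : LearningRule.{u, v, w} 𝓧 A) (R : ObliviousReward 𝓧 A)
    (π : 𝓧 → A) (s : f.Seed) (x : ℕ → 𝓧) (n : ℕ → I) (T : ℕ) :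
    |avgRegret f R π s x n T| ≤ 1 := by
  unfold avgRegret
  rw [abs_mul, abs_of_nonneg (by positivity)]
  have h : |∑ t ∈ Finset.range T, ((R.reward t (n t) (π (x t)) (x t) : ℝ) -
      (R.reward t (n t) (action f R s x n t) (x t) : ℝ))| ≤ T := by
    refine (Finset.abs_sum_le_sum_abs _ _).trans ?_
    refine (Finset.sum_le_sum (g := fun _ => (1 : ℝ)) fun t _ => ?_).trans (by simp)
    rw [abs_le]
    have h1 := (R.reward t (n t) (π (x t)) (x t)).2
    have h2 := (R.reward t (n t) (action f R s x n t) (x t)).2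
    constructor <;> linarith [h1.1, h1.2, h2.1, h2.2]
  rcases T.eq_zero_or_pos with rfl | hT
  · simp
  · have : (0 : ℝ) < T := Nat.cast_pos.2 hT
    rw [one_div, inv_mul_le_iff₀ this, mul_one]
    exact h

/-- The probability space of contexts, seed and noise. -/
noncomputable abbrev runLaw (μ : ContextProcess 𝓧) (f : LearningRule.{u, v, w} 𝓧 A) :
    Measure ((ℕ → 𝓧) × f.Seed × (ℕ → I)) :=
  (μ : Measure (ℕ → 𝓧)).prod
    (f.seedLaw.prod (Measure.infinitePi fun _ : ℕ => (volume : Measure I)))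

theorem IsConsistent.ae_eventually_avgRegret_le {μ : ContextProcess 𝓧} {R : ObliviousReward 𝓧 A}
    {f : LearningRule.{u, v, w} 𝓧 A} (h : IsConsistent μ R f) {π : 𝓧 → A} (hπ : Measurable π)
    {δ : ℝ} (hδ : 0 < δ) :
    ∀ᵐ z ∂runLaw μ f, ∀ᶠ T in atTop, avgRegret f R π z.2.1 z.1 z.2.2 T ≤ δ := by
  filter_upwards [h π hπ] with z hz
  refine (eventually_lt_of_limsup_lt (hz.trans_lt hδ) ?_).mono fun T hT => hT.le
  exact isBoundedUnder_of ⟨1, fun T => (abs_le.1 (abs_avgRegret_le_one f R π _ _ _ T)).2⟩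

theorem measurable_action_of_fixed (f : LearningRule.{u, v, w} 𝓧 A) (R : ObliviousReward 𝓧 A)
    (t : ℕ) : Measurable fun z : (ℕ → 𝓧) × f.Seed × (ℕ → I) => action f R z.2.1 z.1 z.2.2 t :=
  (measurable_action f (fun _ : Unit => R) (fun t => (R.measurable_reward t).comp measurable_snd)
    t).comp (measurable_const (a := ()).prodMk measurable_id)

theorem measurable_avgRegret_of_fixed (f : LearningRule.{u, v, w} 𝓧 A) (R : ObliviousReward 𝓧 A)
    {π : 𝓧 → A} (hπ : Measurable π) (T : ℕ) :
    Measurable fun z : (ℕ → 𝓧) × f.Seed × (ℕ → I) => avgRegret f R π z.2.1 z.1 z.2.2 T :=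
  (measurable_avgRegret f (fun _ : Unit => R) (fun t => (R.measurable_reward t).comp measurable_snd)
    (fun _ => π) (hπ.comp measurable_snd) T).comp (measurable_const (a := ()).prodMk measurable_id)

/-- Under a consistent rule the expected average regret has nonpositive limit superior. -/
theorem IsConsistent.eventually_integral_avgRegret_le {μ : ContextProcess 𝓧}
    {R : ObliviousReward 𝓧 A} {f : LearningRule.{u, v, w} 𝓧 A} (h : IsConsistent μ R f)
    {π : 𝓧 → A} (hπ : Measurable π) {δ : ℝ} (hδ : 0 < δ) :
    ∀ᶠ T in atTop, ∫ z, avgRegret f R π z.2.1 z.1 z.2.2 T ∂runLaw μ f ≤ δ :=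
  eventually_integral_le_of_ae_eventually_le (fun T => measurable_avgRegret_of_fixed f R hπ T)
    (fun _ _ => abs_avgRegret_le_one _ _ _ _ _ _ _)
    (fun _ hδ => h.ae_eventually_avgRegret_le hπ hδ) hδ

end Interaction

/-! ### First visits -/

section FirstVisits

variable {𝓧 : Type u}

/-- Round `t` is the first one in which some member of the family `B` is visited. -/
def IsFirstVisit (B : ℕ → Set 𝓧) (x : ℕ → 𝓧) (t : ℕ) : Prop :=
  ∃ k, x t ∈ B k ∧ ∀ s < t, x s ∉ B k

theorem measurableSet_isFirstVisit [MeasurableSpace 𝓧] {B : ℕ → Set 𝓧}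
    (hB : ∀ k, MeasurableSet (B k)) (t : ℕ) : MeasurableSet {x : ℕ → 𝓧 | IsFirstVisit B x t} := by
  have h : ∀ s k, MeasurableSet {x : ℕ → 𝓧 | x s ∈ B k} := fun s k => measurable_pi_apply s (hB k)
  have : {x : ℕ → 𝓧 | IsFirstVisit B x t} =
      ⋃ k, ({x | x t ∈ B k} ∩ ⋂ s, ⋂ _ : s < t, {x | x s ∈ B k}ᶜ) := by
    ext x; simp [IsFirstVisit]
  rw [this]
  exact .iUnion fun k => (h t k).inter (.iInter fun s => .iInter fun _ => (h s k).compl)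

open Classical in
/-- The visited members of a disjoint family are in bijection with their first visits. -/
theorem visitedCount_eq_card {B : ℕ → Set 𝓧} (hd : Pairwise (Function.onFun Disjoint B))
    (x : ℕ → 𝓧) (T : ℕ) :
    visitedCount B x T = (Finset.filter (IsFirstVisit B x) (Finset.range T)).card := by
  rw [← Set.ncard_coe_finset]
  refine (Set.ncard_congr (fun t ht => (Finset.mem_filter.1 ht).2.choose) ?_ ?_ ?_).symm
  · intro t ht
    exact ⟨t, Finset.mem_range.1 (Finset.mem_filter.1 ht).1,
      (Finset.mem_filter.1 ht).2.choose_spec.1⟩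
  · intro t t' ht ht' h
    have h1 := (Finset.mem_filter.1 ht).2.choose_spec
    have h2 := (Finset.mem_filter.1 ht').2.choose_spec
    rcases lt_trichotomy t t' with hlt | rfl | hlt
    · exact absurd (h ▸ h1.1) (h2.2 t hlt)
    · rfl
    · exact absurd (h ▸ h2.1) (h1.2 t' hlt)
  · rintro k ⟨t, hT, hk⟩
    have hex : ∃ t, x t ∈ B k := ⟨t, hk⟩
    have hf : IsFirstVisit B x (Nat.find hex) :=
      ⟨k, Nat.find_spec hex, fun s hs => Nat.find_min hex hs⟩
    have hm : Nat.find hex ∈ ((Finset.filter (IsFirstVisit B x) (Finset.range T) : Finset ℕ) :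
        Set ℕ) := by
      simp only [Finset.coe_filter, Finset.mem_range, Set.mem_ofPred_eq]
      exact ⟨(Nat.find_min' hex hk).trans_lt hT, hf⟩
    refine ⟨_, hm, ?_⟩
    by_contra hne
    exact Set.disjoint_left.1 (hd hne) (Finset.mem_filter.1 hm).2.choose_spec.1
      (Nat.find_spec hex)

theorem measurable_visitedCount [MeasurableSpace 𝓧] {B : ℕ → Set 𝓧}
    (hB : ∀ k, MeasurableSet (B k)) (hd : Pairwise (Function.onFun Disjoint B)) (T : ℕ) :
    Measurable fun x : ℕ → 𝓧 => visitedCount B x T := by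
  classical
  have : (fun x : ℕ → 𝓧 => visitedCount B x T) = fun x => ∑ t ∈ Finset.range T,
      Set.indicator {x : ℕ → 𝓧 | IsFirstVisit B x t} (fun _ => 1) x := by
    ext x
    rw [visitedCount_eq_card hd, Finset.card_filter]
    rfl
  rw [this]
  exact Finset.measurable_sum _ fun t _ =>
    measurable_const.indicator (measurableSet_isFirstVisit hB t)

/-- Outside of `C₂`, for some family of disjoint sets the number of visited members is linear in
time at arbitrarily late times, with a probability that is bounded from below. Since the measure is
continuous along increasing unions, the bound `L` on the time and on the indices of the visited
members can be chosen independently of the path. -/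
theorem exists_frequent_visits_of_notMem_C2 [MeasurableSpace 𝓧] {μ : ContextProcess 𝓧}
    (hμ : μ ∉ C2 𝓧) :
    ∃ B : ℕ → Set 𝓧, (∀ k, MeasurableSet (B k)) ∧ Pairwise (Function.onFun Disjoint B) ∧
      ∃ ε : ℝ, 0 < ε ∧ ∀ K, ∃ L, ENNReal.ofReal ε ≤ (μ : Measure (ℕ → 𝓧))
        {x | ∃ T, K ≤ T ∧ T ≤ L ∧ ε * T ≤ visitedCount B x T ∧
          ∀ t < T, ∀ k, x t ∈ B k → k < L} := by
  simp only [C2, Set.mem_ofPred_eq, not_forall] at hμ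
  obtain ⟨B, hB, hd, h⟩ := hμ
  refine ⟨B, hB, hd, ?_⟩
  have hex : ∃ m : ℕ, (μ : Measure (ℕ → 𝓧))
      {x | ∃ᶠ T in atTop, 1 / ((m : ℝ) + 1) * T < visitedCount B x T} ≠ 0 := by
    by_contra hcon
    push Not at hcon
    refine h ?_
    have h' := ae_all_iff.2 fun m : ℕ => (ae_iff (p := fun x : ℕ → 𝓧 =>
      ¬ ∃ᶠ T in atTop, 1 / ((m : ℝ) + 1) * T < visitedCount B x T)).2
        (by simp only [not_not]; exact hcon m)
    filter_upwards [h'] with x hx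
    refine Asymptotics.isLittleO_iff.2 fun c hc => ?_
    obtain ⟨m, hm⟩ := exists_nat_one_div_lt hc
    have := hx m
    rw [not_frequently] at this
    filter_upwards [this] with T hT
    rw [not_lt] at hT
    simp only [Real.norm_natCast]
    exact hT.trans (mul_le_mul_of_nonneg_right hm.le (Nat.cast_nonneg _))
  obtain ⟨m, hm⟩ := hex
  set E : Set (ℕ → 𝓧) := {x | ∃ᶠ T in atTop, 1 / ((m : ℝ) + 1) * T < visitedCount B x T} with hE
  set p : ℝ := (μ : Measure (ℕ → 𝓧)).real E with hp
  have hp0 : 0 < p := by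
    rw [hp, measureReal_def]
    exact ENNReal.toReal_pos hm (measure_ne_top _ _)
  refine ⟨min (p / 2) (1 / ((m : ℝ) + 1)), lt_min (by linarith) Nat.one_div_pos_of_nat,
    fun K => ?_⟩
  set ε := min (p / 2) (1 / ((m : ℝ) + 1)) with hε
  set G : ℕ → Set (ℕ → 𝓧) := fun L => {x | ∃ T, K ≤ T ∧ T ≤ L ∧ ε * T ≤ visitedCount B x T ∧
          ∀ t < T, ∀ k, x t ∈ B k → k < L} with hG
  have hmono : Monotone G := by
    rintro L L' hL x ⟨T, h1, h2, h3, h4⟩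
    exact ⟨T, h1, h2.trans hL, h3, fun t ht k hk => (h4 t ht k hk).trans_le hL⟩
  have hsub : E ⊆ ⋃ L, G L := by
    intro x hx
    obtain ⟨T, hT, hTx⟩ := frequently_atTop.1 hx K
    have hfin : ∃ M, ∀ t < T, ∀ k, x t ∈ B k → k < M := by
      have : ∀ t, ∃ M, ∀ k, x t ∈ B k → k < M := by
        intro t
        by_cases hk : ∃ k, x t ∈ B k
        · obtain ⟨k, hk⟩ := hk
          refine ⟨k + 1, fun k' hk' => ?_⟩
          have : k' = k := by
            by_contra hne
            exact Set.disjoint_left.1 (hd hne) hk' hk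
          omega
        · exact ⟨0, fun k hk' => absurd ⟨k, hk'⟩ hk⟩
      choose M hM using this
      refine ⟨(Finset.range T).sup M, fun t ht k hk => (hM t k hk).trans_le ?_⟩
      exact Finset.le_sup (Finset.mem_range.2 ht)
    obtain ⟨M, hM⟩ := hfin
    refine Set.mem_iUnion.2 ⟨max T M, T, hT, le_max_left _ _, ?_, fun t ht k hk =>
      (hM t ht k hk).trans_le (le_max_right _ _)⟩
    exact (mul_le_mul_of_nonneg_right (min_le_right _ _) (Nat.cast_nonneg _)).trans hTx.le
  have hlim := tendsto_measure_iUnion_atTop (μ := (μ : Measure (ℕ → 𝓧))) hmono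
  have hlt : ENNReal.ofReal ε < (μ : Measure (ℕ → 𝓧)) (⋃ L, G L) := by
    refine lt_of_lt_of_le ?_ (measure_mono hsub)
    rw [← ENNReal.ofReal_toReal (measure_ne_top (μ : Measure (ℕ → 𝓧)) E)]
    refine (ENNReal.ofReal_lt_ofReal_iff hp0).2 ?_
    exact (min_le_left _ _).trans_lt (by linarith)
  obtain ⟨L, hL⟩ := (hlim.eventually (lt_mem_nhds hlt)).exists
  exact ⟨L, hL.le⟩

/-! ### `C₄` is contained in `C₂` -/

/-- For `i ≤ u` the floor in the definition of `scaleTime` is taken of an integer. -/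
theorem scaleTime_add (i u v : ℕ) (hv : v < 2 ^ i) (hi : i ≤ u) :
    scaleTime i (u * 2 ^ i + v) = 2 ^ u + v * 2 ^ (u - i) := by
  have hpos : 0 < 2 ^ i := by positivity
  have h1 : (u * 2 ^ i + v) / 2 ^ i = u := by
    rw [mul_comm, Nat.mul_add_div hpos, Nat.div_eq_of_lt hv, add_zero]
  have h2 : (u * 2 ^ i + v) % 2 ^ i = v := by
    rw [mul_comm, Nat.mul_add_mod, Nat.mod_eq_of_lt hv]
  unfold scaleTime
  rw [h1, h2]
  have : (2 : ℝ) ^ u * (1 + (v : ℝ) / 2 ^ i) = ((2 ^ u + v * 2 ^ (u - i) : ℕ) : ℝ) := by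
    push_cast
    rw [pow_sub₀ (2 : ℝ) two_ne_zero hi]
    field_simp
  rw [this, Nat.floor_natCast]

theorem scaleTime_mul (i u : ℕ) : scaleTime i (u * 2 ^ i) = 2 ^ u := by
  have hpos : 0 < 2 ^ i := by positivity
  unfold scaleTime
  rw [Nat.mul_div_cancel _ hpos, Nat.mul_mod_left]
  simp only [Nat.cast_zero, zero_div, add_zero, mul_one]
  exact_mod_cast Nat.floor_natCast (R := ℝ) (2 ^ u)

/-- The periods of scale `i` cover all times. -/
theorem exists_scaleTime_period (i t : ℕ) :
    ∃ k, scaleTime i k ≤ t + 1 ∧ t + 1 < scaleTime i (k + 1) := by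
  have hex : ∃ k, t + 1 < scaleTime i k := by
    refine ⟨(t + 1) * 2 ^ i, ?_⟩
    rw [scaleTime_mul]
    exact Nat.lt_two_pow_self
  have h0 : Nat.find hex ≠ 0 := by
    intro h
    have := Nat.find_spec hex
    rw [h] at this
    have h1 := scaleTime_mul i 0
    rw [zero_mul] at h1
    omega
  obtain ⟨k, hk⟩ := Nat.exists_eq_succ_of_ne_zero h0
  refine ⟨k, ?_, ?_⟩
  · exact not_lt.1 (Nat.find_min hex (by omega))
  · have := Nat.find_spec hex
    rwa [hk] at this

/-- A lower bound on the frequency `scaleFreq` from the times in a given set. -/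
theorem le_scaleFreq_of_frequently {i : ℕ} {B : Set 𝓧} {x : ℕ → 𝓧} {c : ℝ}
    (h : ∃ᶠ T in atTop, ∃ F : Finset ℕ, F ⊆ Finset.range T ∧
      (∀ t ∈ F, t ∈ firstTimes i x ∧ x t ∈ B) ∧ c * T ≤ F.card) :
    ENNReal.ofReal c ≤ scaleFreq i B x := by
  unfold scaleFreq
  refine le_limsup_of_frequently_le ?_
  refine (h.and_eventually (eventually_gt_atTop 0)).mono ?_
  rintro T ⟨⟨F, hF, hF', hc⟩, hT⟩
  have hT' : (T : ℝ≥0∞) ≠ 0 := by exact_mod_cast hT.ne'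
  rw [ENNReal.le_div_iff_mul_le (Or.inl hT') (Or.inl (ENNReal.natCast_ne_top T))]
  calc ENNReal.ofReal c * T = ENNReal.ofReal (c * T) := by
        rw [ENNReal.ofReal_mul' (Nat.cast_nonneg _), ENNReal.ofReal_natCast]
    _ ≤ ENNReal.ofReal F.card := ENNReal.ofReal_le_ofReal hc
    _ = ∑ t ∈ F, (1 : ℝ≥0∞) := by simp
    _ = ∑ t ∈ F, Set.indicator {t : ℕ | t ∈ firstTimes i x ∧ x t ∈ B} (fun _ => (1 : ℝ≥0∞)) t :=
        Finset.sum_congr rfl fun t ht => by rw [Set.indicator_of_mem]; exact hF' t ht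
    _ ≤ _ := Finset.sum_le_sum_of_subset hF

end FirstVisits

/-- For a process outside of `C₂` the family of `exists_frequent_visits_of_notMem_C2` is cut into
consecutive blocks, each of which accounts for linearly many first visits with a probability that is
bounded from below. The blocks are distributed among sets `B' i` which receive infinitely many
blocks each. A first visit is a first appearance in its period, whatever the scale, so `B'` violates
the condition of `C₄`. -/
theorem C4_subset_C2 (𝓧 : Type u) [MeasurableSpace 𝓧] : C4 𝓧 ⊆ C2 𝓧 := by
  classical
  intro μ hμ
  by_contra hC2
  obtain ⟨B, hB, hd, ε, hε, hL⟩ := exists_frequent_visits_of_notMem_C2 hC2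
  -- At most `K` first visits are to members with index below `K`, and these are negligible at times
  -- `T ≥ 2 * K / ε`.
  have hstep : ∀ K : ℕ, ∃ L : ℕ, K < L ∧ ENNReal.ofReal ε ≤ (μ : Measure (ℕ → 𝓧))
      {x | ∃ T, K ≤ T ∧ ∃ F : Finset ℕ, F ⊆ Finset.range T ∧ ε / 2 * T ≤ F.card ∧
        ∀ t ∈ F, ∃ k, K ≤ k ∧ k < L ∧ x t ∈ B k ∧ ∀ s < t, x s ∉ B k} := by
    intro K
    obtain ⟨K', hK'⟩ := exists_nat_ge (2 * K / ε)
    obtain ⟨L, hL⟩ := hL (max K K')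
    refine ⟨max L (K + 1), by omega, hL.trans (measure_mono ?_)⟩
    rintro x ⟨T, hKT, hTL, hT, hvis⟩
    refine ⟨T, (le_max_left _ _).trans hKT,
      Finset.filter (fun t => ∃ k, K ≤ k ∧ k < max L (K + 1) ∧ x t ∈ B k ∧ ∀ s < t, x s ∉ B k)
        (Finset.range T), Finset.filter_subset _ _, ?_, fun t ht => (Finset.mem_filter.1 ht).2⟩
    rw [visitedCount_eq_card hd] at hT
    have hsub : Finset.filter (IsFirstVisit B x) (Finset.range T) ⊆
        Finset.filter (fun t => ∃ k, K ≤ k ∧ k < max L (K + 1) ∧ x t ∈ B k ∧ ∀ s < t, x s ∉ B k)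
          (Finset.range T) ∪
        Finset.filter (fun t => ∃ k, k < K ∧ x t ∈ B k ∧ ∀ s < t, x s ∉ B k)
          (Finset.range T) := by
      intro t ht
      obtain ⟨htT, k, hk, hks⟩ := Finset.mem_filter.1 ht
      rw [Finset.mem_union, Finset.mem_filter, Finset.mem_filter]
      rcases Nat.lt_or_ge k K with h | h
      · exact Or.inr ⟨htT, k, h, hk, hks⟩
      · exact Or.inl ⟨htT, k, h, lt_max_of_lt_left (hvis t (Finset.mem_range.1 htT) k hk), hk, hks⟩
    have hcard : (Finset.filter (fun t => ∃ k, k < K ∧ x t ∈ B k ∧ ∀ s < t, x s ∉ B k)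
          (Finset.range T)).card ≤ K := by
      refine le_of_le_of_eq ?_ (Finset.card_range K)
      refine Finset.card_le_card_of_forall_subsingleton (fun t k => x t ∈ B k ∧ ∀ s < t, x s ∉ B k)
        (fun t ht => ?_) (fun k hk t ht t' ht' => ?_)
      · obtain ⟨k, hk, h⟩ := (Finset.mem_filter.1 ht).2
        exact ⟨k, Finset.mem_range.2 hk, h⟩
      · rcases lt_trichotomy t t' with hlt | heq | hlt
        · exact absurd ht.2.1 (ht'.2.2 t hlt)
        · exact heq
        · exact absurd ht'.2.1 (ht.2.2 t' hlt)
    have h1 := (Finset.card_le_card hsub).trans (Finset.card_union_le _ _)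
    have h2 : (K : ℝ) ≤ ε / 2 * T := by
      have : (K' : ℝ) ≤ T := by exact_mod_cast (le_max_right K K').trans hKT
      have h3 := hK'.trans this
      rw [div_le_iff₀ hε] at h3
      linarith
    have h3 : ((Finset.filter (IsFirstVisit B x) (Finset.range T)).card : ℝ) ≤
      (Finset.filter (fun t => ∃ k, K ≤ k ∧ k < max L (K + 1) ∧ x t ∈ B k ∧ ∀ s < t, x s ∉ B k)
          (Finset.range T)).card + K := by exact_mod_cast h1.trans (by omega)
    linarith
  choose L hKL hmeas using hstep
  -- Block `j` consists of the indices in `[κ j, κ (j + 1))` and belongs to `B' (Nat.unpair j).1`.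
  set κ : ℕ → ℕ := fun j => L^[j] 0 with hκ
  have hκs : ∀ j, κ (j + 1) = L (κ j) := fun j => Function.iterate_succ_apply' L j 0
  have hκm : StrictMono κ := strictMono_nat_of_lt_succ fun j => by rw [hκs]; exact hKL _
  set B' : ℕ → Set 𝓧 := fun i => ⋃ j, ⋃ _ : (Nat.unpair j).1 = i, ⋃ k,
    ⋃ _ : κ j ≤ k ∧ k < κ (j + 1), B k with hB'
  have hB'm : ∀ i, MeasurableSet (B' i) := fun i => .iUnion fun j => .iUnion fun _ =>
    .iUnion fun k => .iUnion fun _ => hB k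
  have hB'd : Pairwise (Function.onFun Disjoint B') := by
    intro i i' hne
    refine Set.disjoint_left.2 fun y hy hy' => hne ?_
    simp only [hB', Set.mem_iUnion, exists_prop] at hy hy'
    obtain ⟨j, rfl, k, hk, hyk⟩ := hy
    obtain ⟨j', rfl, k', hk', hyk'⟩ := hy'
    have hkk : k = k' := by
      by_contra h
      exact Set.disjoint_left.1 (hd h) hyk hyk'
    subst hkk
    have : j = j' := by
      rcases lt_trichotomy j j' with h | h | h
      · have := hκm.monotone (Nat.succ_le_of_lt h); simp only [Nat.succ_eq_add_one] at this; omega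
      · exact h
      · have := hκm.monotone (Nat.succ_le_of_lt h); simp only [Nat.succ_eq_add_one] at this; omega
    rw [this]
  have hlim := hμ B' hB'm hB'd
  -- The event that block `j` accounts for linearly many first visits at some time.
  set E : ℕ → Set (ℕ → 𝓧) := fun j =>
      {x | ∃ T, κ j ≤ T ∧ ∃ F : Finset ℕ, F ⊆ Finset.range T ∧ ε / 2 * T ≤ F.card ∧
        ∀ t ∈ F, ∃ k, κ j ≤ k ∧ k < κ (j + 1) ∧ x t ∈ B k ∧ ∀ s < t, x s ∉ B k} with hE
  have hEμ : ∀ j, ENNReal.ofReal ε ≤ (μ : Measure (ℕ → 𝓧)) (E j) := fun j => by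
    rw [hE]; simp only [hκs]; exact hmeas (κ j)
  have hlow : ∀ i, ENNReal.ofReal (ε / 2) * ENNReal.ofReal ε ≤
      ∫⁻ x, scaleFreq i (B' i) x ∂(μ : Measure (ℕ → 𝓧)) := by
    intro i
    have hEm : ∀ j, MeasurableSet (E j) := by
      intro j
      have h : ∀ s k, MeasurableSet {x : ℕ → 𝓧 | x s ∈ B k} :=
        fun s k => measurable_pi_apply s (hB k)
      refine MeasurableSet.congr (s := ⋃ T, ⋃ _ : κ j ≤ T, ⋃ F : Finset ℕ,
        ⋃ _ : F ⊆ Finset.range T ∧ ε / 2 * T ≤ F.card, ⋂ t, ⋂ _ : t ∈ F, ⋃ k,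
        ⋃ _ : κ j ≤ k ∧ k < κ (j + 1),
          ({x : ℕ → 𝓧 | x t ∈ B k} ∩ ⋂ s, ⋂ _ : s < t, {x | x s ∈ B k}ᶜ)) ?_ ?_
      · exact .iUnion fun T => .iUnion fun _ => .iUnion fun F => .iUnion fun _ => .iInter fun t =>
          .iInter fun _ => .iUnion fun k => .iUnion fun _ =>
          (h t k).inter (.iInter fun s => .iInter fun _ => (h s k).compl)
      · ext x
        simp only [hE, Set.mem_iUnion, exists_prop, Set.mem_inter_iff, Set.mem_iInter,
          Set.mem_compl_iff, Set.mem_ofPred_eq, and_assoc]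
    -- Infinitely many of the events of the blocks in `B' i` occur with probability at least `ε`.
    set G : ℕ → Set (ℕ → 𝓧) := fun N => ⋃ n, ⋃ _ : N ≤ n, E (Nat.pair i n) with hG
    have hGm : ∀ N, MeasurableSet (G N) := fun N => .iUnion fun n => .iUnion fun _ => hEm _
    have hGa : Antitone G := fun N N' h =>
      Set.iUnion_mono fun n => Set.iUnion_subset fun hn => Set.subset_iUnion_of_subset (h.trans hn)
        subset_rfl
    have hGlim := tendsto_measure_iInter_atTop (μ := (μ : Measure (ℕ → 𝓧)))
      (fun N => (hGm N).nullMeasurableSet) hGa ⟨0, measure_ne_top _ _⟩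
    have hGμ : ENNReal.ofReal ε ≤ (μ : Measure (ℕ → 𝓧)) (⋂ N, G N) :=
      ge_of_tendsto' hGlim fun N => (hEμ (Nat.pair i N)).trans
        (measure_mono (Set.subset_iUnion_of_subset N (Set.subset_iUnion_of_subset le_rfl
          subset_rfl)))
    refine (mul_le_mul_right hGμ _).trans ?_
    rw [← lintegral_indicator_const (.iInter hGm)]
    refine lintegral_mono fun x => ?_
    by_cases hx : x ∈ ⋂ N, G N
    · rw [Set.indicator_of_mem hx]
      refine le_scaleFreq_of_frequently (frequently_atTop.2 fun N => ?_)
      have hxN := Set.mem_iInter.1 hx N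
      simp only [hG, Set.mem_iUnion, exists_prop] at hxN
      obtain ⟨n, hn, T, hT, F, hFT, hFc, hF⟩ := hxN
      refine ⟨T, ?_, F, hFT, fun t ht => ?_, hFc⟩
      · exact ((hn.trans (Nat.right_le_pair i n)).trans hκm.le_apply).trans hT
      · obtain ⟨k, h1, h2, h3, h4⟩ := hF t ht
        constructor
        · obtain ⟨l, hl1, hl2⟩ := exists_scaleTime_period i t
          exact ⟨l, hl1, hl2, fun s hs _ heq => h4 s hs (heq ▸ h3)⟩
        · simp only [hB', Set.mem_iUnion, exists_prop]
          exact ⟨Nat.pair i n, by rw [Nat.unpair_pair], k, ⟨h1, h2⟩, h3⟩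
    · rw [Set.indicator_of_notMem hx]
      exact zero_le
  have := ge_of_tendsto' hlim hlow
  have h0 : ENNReal.ofReal (ε / 2) * ENNReal.ofReal ε ≠ 0 := by
    simp [hε]
  exact h0 (nonpos_iff_eq_zero.1 this)

/-! ### Deterministic rewards and fair coins -/

/-- The reward mechanism in which the reward is a function of round, action and context. -/
noncomputable def ObliviousReward.ofFun {𝓧 : Type u} {A : Type v} [MeasurableSpace 𝓧]
    [MeasurableSpace A] (r : ℕ → A → 𝓧 → I)
    (hr : ∀ t, Measurable fun p : A × 𝓧 => r t p.1 p.2) : ObliviousReward 𝓧 A where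
  dist t := Kernel.deterministic (fun p : A × 𝓧 => r t p.1 p.2) (hr t)
  reward t _ a x := r t a x
  measurable_reward t := (hr t).comp measurable_snd
  map_reward t a x := by
    rw [Measure.map_const, measure_univ, one_smul, Kernel.deterministic_apply]

/-- The uniform distribution on bits. -/
noncomputable def fairCoin : Measure Bool :=
  (2⁻¹ : ℝ≥0∞) • (Measure.dirac true + Measure.dirac false)

instance : IsProbabilityMeasure fairCoin := ⟨by
  simp only [fairCoin, Measure.smul_apply, Measure.add_apply, measure_univ, smul_eq_mul]
  rw [one_add_one_eq_two, ENNReal.inv_mul_cancel two_ne_zero ENNReal.ofNat_ne_top]⟩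

theorem map_not_fairCoin : fairCoin.map not = fairCoin := by
  simp only [fairCoin]
  rw [Measure.map_smul, Measure.map_add _ _ (measurable_of_finite _),
    Measure.map_dirac' (measurable_of_finite _), Measure.map_dirac' (measurable_of_finite _),
    add_comm]
  rfl

/-- The law of a sequence of independent fair bits. -/
noncomputable def fairCoins : Measure (ℕ → Bool) := Measure.infinitePi fun _ => fairCoin

instance : IsProbabilityMeasure fairCoins := by unfold fairCoins; infer_instance

theorem measurePreserving_update_not (k : ℕ) :
    MeasurePreserving (fun b : ℕ → Bool => Function.update b k (!b k)) fairCoins fairCoins := by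
  have hf : ∀ i, Measurable (if i = k then not else id : Bool → Bool) :=
    fun i => measurable_of_finite _
  have heq : (fun b : ℕ → Bool => Function.update b k (!b k)) =
      fun b i => (if i = k then not else id : Bool → Bool) (b i) := by
    ext b i
    by_cases h : i = k
    · subst h; simp
    · simp [h]
  rw [heq]
  refine ⟨by fun_prop, ?_⟩
  unfold fairCoins
  rw [Measure.infinitePi_map_pi _ hf]
  congr 1
  ext1 i
  by_cases h : i = k
  · simp only [h, if_true]; exact map_not_fairCoin
  · simp only [h, if_false]; exact Measure.map_id

/-! ### Learnable processes are in `C₂` -/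

section Memorization

variable {𝓧 : Type u} {A : Type v}

/-- The union of the members of the family `B` whose bit is set. -/
def selectedUnion (B : ℕ → Set 𝓧) (b : ℕ → Bool) : Set 𝓧 := {x | ∃ k, b k = true ∧ x ∈ B k}

theorem measurableSet_selectedUnion [MeasurableSpace 𝓧] {B : ℕ → Set 𝓧}
    (hB : ∀ k, MeasurableSet (B k)) :
    MeasurableSet {p : (ℕ → Bool) × 𝓧 | p.2 ∈ selectedUnion B p.1} := by
  have : {p : (ℕ → Bool) × 𝓧 | p.2 ∈ selectedUnion B p.1} =
      ⋃ k, {b : ℕ → Bool | b k = true} ×ˢ B k := by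
    ext p; simp [selectedUnion]
  rw [this]
  refine .iUnion fun k => MeasurableSet.prod ?_ (hB k)
  exact measurable_pi_apply (X := fun _ : ℕ => Bool) k (measurableSet_singleton true)

theorem mem_selectedUnion_iff {B : ℕ → Set 𝓧} (hd : Pairwise (Function.onFun Disjoint B))
    (b : ℕ → Bool) {x : 𝓧} {k : ℕ} (hx : x ∈ B k) : x ∈ selectedUnion B b ↔ b k = true := by
  refine ⟨fun ⟨k', hk', hx'⟩ => ?_, fun h => ⟨k, h, hx⟩⟩
  by_contra h
  have hne : k' ≠ k := fun h' => h (h' ▸ hk')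
  exact Set.disjoint_left.1 (hd hne) hx' hx

theorem mem_selectedUnion_update {B : ℕ → Set 𝓧} (b : ℕ → Bool) {x : 𝓧} {k : ℕ} (hx : x ∉ B k)
    (c : Bool) : x ∈ selectedUnion B (Function.update b k c) ↔ x ∈ selectedUnion B b := by
  refine exists_congr fun j => ?_
  by_cases h : j = k
  · subst h; simp [hx]
  · rw [Function.update_of_ne h]

variable [MeasurableSpace 𝓧] [MeasurableSpace A]

open Classical in
/-- The policy that plays `a₂` on the selected sets and `a₁` off them. Under `bitReward` it is
rewarded in every round. -/
noncomputable def bitPolicy (B : ℕ → Set 𝓧) (a₁ a₂ : A) (b : ℕ → Bool) (x : 𝓧) : A :=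
  if x ∈ selectedUnion B b then a₂ else a₁

theorem measurable_bitPolicy {B : ℕ → Set 𝓧} (hB : ∀ k, MeasurableSet (B k)) (a₁ a₂ : A) :
    Measurable fun z : (ℕ → Bool) × 𝓧 => bitPolicy B a₁ a₂ z.1 z.2 :=
  Measurable.ite (measurableSet_selectedUnion hB) measurable_const measurable_const

variable [MeasurableSingletonClass A]

theorem measurableSet_rewarded {B : ℕ → Set 𝓧} (hB : ∀ k, MeasurableSet (B k)) (a₁ : A) :
    MeasurableSet {z : (ℕ → Bool) × A × 𝓧 | z.2.1 = a₁ ↔ z.2.2 ∉ selectedUnion B z.1} := by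
  have h1 : MeasurableSet {z : (ℕ → Bool) × A × 𝓧 | z.2.1 = a₁} :=
    (measurable_fst.comp measurable_snd) (measurableSet_singleton a₁)
  have h2 : MeasurableSet {z : (ℕ → Bool) × A × 𝓧 | z.2.2 ∉ selectedUnion B z.1} :=
    ((measurable_fst.prodMk (measurable_snd.comp measurable_snd))
      (measurableSet_selectedUnion hB)).compl
  exact h1.iff h2

open Classical in
/-- The rewards that reveal the bits of visited sets: `a₁` is rewarded off the selected sets, and
all other actions are rewarded on them. -/
noncomputable def bitReward (B : ℕ → Set 𝓧) (hB : ∀ k, MeasurableSet (B k)) (a₁ : A)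
    (b : ℕ → Bool) : ObliviousReward 𝓧 A :=
  .ofFun (fun _ a x => if a = a₁ ↔ x ∉ selectedUnion B b then 1 else 0) fun _ =>
    Measurable.ite ((measurable_const (a := b)).prodMk measurable_id (measurableSet_rewarded hB a₁))
      measurable_const measurable_const

open Classical in
theorem bitReward_reward (B : ℕ → Set 𝓧) (hB : ∀ k, MeasurableSet (B k)) (a₁ : A) (b : ℕ → Bool)
    (t : ℕ) (y : I) (a : A) (x : 𝓧) : (bitReward B hB a₁ b).reward t y a x =
      if a = a₁ ↔ x ∉ selectedUnion B b then 1 else 0 := rfl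

theorem measurable_bitReward {B : ℕ → Set 𝓧} (hB : ∀ k, MeasurableSet (B k)) (a₁ : A) (t : ℕ) :
    Measurable fun z : (ℕ → Bool) × I × A × 𝓧 =>
      (bitReward B hB a₁ z.1).reward t z.2.1 z.2.2.1 z.2.2.2 :=
  Measurable.ite ((measurable_fst.prodMk (measurable_snd.comp measurable_snd))
    (measurableSet_rewarded hB a₁)) measurable_const measurable_const

variable (B : ℕ → Set 𝓧) (hB : ∀ k, MeasurableSet (B k)) (a₁ a₂ : A)
  (f : LearningRule.{u, v, w} 𝓧 A) (s : f.Seed) (x : ℕ → 𝓧) (n : ℕ → I)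

open Classical in
/-- The indicator of the event that an unrewarded action is selected. -/
noncomputable def mistake (b : ℕ → Bool) (t : ℕ) : ℝ :=
  if action f (bitReward B hB a₁ b) s x n t = a₁ ↔ x t ∉ selectedUnion B b then 0 else 1

theorem mistake_nonneg (b : ℕ → Bool) (t : ℕ) : 0 ≤ mistake B hB a₁ f s x n b t := by
  unfold mistake; split_ifs <;> norm_num

theorem avgRegret_bitReward (ha : a₁ ≠ a₂) (b : ℕ → Bool) (T : ℕ) :
    avgRegret f (bitReward B hB a₁ b) (bitPolicy B a₁ a₂ b) s x n T =
      (1 / (T : ℝ)) * ∑ t ∈ Finset.range T, mistake B hB a₁ f s x n b t := by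
  unfold avgRegret
  congr 1
  refine Finset.sum_congr rfl fun t _ => ?_
  have h1 : (bitReward B hB a₁ b).reward t (n t) (bitPolicy B a₁ a₂ b (x t)) (x t) = 1 := by
    refine if_pos ?_
    unfold bitPolicy
    by_cases h : x t ∈ selectedUnion B b
    · simp [h, ha.symm]
    · simp [h]
  rw [h1]
  unfold mistake
  by_cases h : action f (bitReward B hB a₁ b) s x n t = a₁ ↔ x t ∉ selectedUnion B b
  · rw [if_pos h, show (bitReward B hB a₁ b).reward t (n t)
      (action f (bitReward B hB a₁ b) s x n t) (x t) = 1 from if_pos h]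
    simp
  · rw [if_neg h, show (bitReward B hB a₁ b).reward t (n t)
      (action f (bitReward B hB a₁ b) s x n t) (x t) = 0 from if_neg h]
    simp

theorem measurable_mistake (t : ℕ) :
    Measurable fun b : ℕ → Bool => mistake B hB a₁ f s x n b t := by
  refine Measurable.ite ?_ measurable_const measurable_const
  have h := measurable_action f (bitReward B hB a₁) (measurable_bitReward hB a₁) t
  have h' : Measurable fun b : ℕ → Bool =>
      (b, action f (bitReward B hB a₁ b) s x n t, x t) :=
    measurable_id.prodMk ((h.comp (measurable_id.prodMk
      (measurable_const (a := ((x, s, n) : (ℕ → 𝓧) × f.Seed × (ℕ → I)))))).prodMk measurable_const)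
  exact h' (measurableSet_rewarded hB a₁)

theorem integrable_mistake (t : ℕ) :
    Integrable (fun b : ℕ → Bool => mistake B hB a₁ f s x n b t) fairCoins := by
  refine Integrable.of_bound (measurable_mistake B hB a₁ f s x n t).aestronglyMeasurable 1
    (ae_of_all _ fun b => ?_)
  unfold mistake; split_ifs <;> simp

/-- At the first visit to a member of the family the rule knows nothing about its bit: flipping the
bit does not change the action, but turns mistakes into correct plays and conversely. -/
theorem integral_mistake_of_isFirstVisit (hd : Pairwise (Function.onFun Disjoint B)) {t : ℕ}
    (ht : IsFirstVisit B x t) : ∫ b, mistake B hB a₁ f s x n b t ∂fairCoins = 1 / 2 := by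
  obtain ⟨k, hk, hks⟩ := ht
  have hflip : ∀ b : ℕ → Bool, mistake B hB a₁ f s x n (Function.update b k (!b k)) t =
      1 - mistake B hB a₁ f s x n b t := by
    intro b
    have hact : action f (bitReward B hB a₁ b) s x n t =
        action f (bitReward B hB a₁ (Function.update b k (!b k))) s x n t := by
      refine action_congr f s x n t fun j hj => ?_
      rw [bitReward_reward, bitReward_reward, mem_selectedUnion_update b (hks j hj)]
    unfold mistake
    rw [← hact, mem_selectedUnion_iff hd b hk, mem_selectedUnion_iff hd _ hk,
      Function.update_self]
    by_cases h1 : action f (bitReward B hB a₁ b) s x n t = a₁ <;> cases b k <;> simp [h1]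
  have h1 := (measurePreserving_update_not k).integral_comp'
    (f := MeasurableEquiv.ofInvolutive (fun b : ℕ → Bool => Function.update b k (!b k))
      (fun b => by simp) (measurePreserving_update_not k).measurable)
    (fun b => mistake B hB a₁ f s x n b t)
  have h2 : ∫ b, mistake B hB a₁ f s x n (Function.update b k (!b k)) t ∂fairCoins =
      ∫ b, mistake B hB a₁ f s x n b t ∂fairCoins := h1
  simp only [hflip] at h2
  rw [integral_sub (integrable_const _) (integrable_mistake B hB a₁ f s x n t)] at h2
  simp at h2
  linarith

/-- For random bits the expected number of mistakes is at least half of the number of first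
visits. -/
theorem half_visitedCount_le_integral (hd : Pairwise (Function.onFun Disjoint B))
    (ha : a₁ ≠ a₂) (T : ℕ) :
    1 / (T : ℝ) * (1 / 2 * visitedCount B x T) ≤
      ∫ b, avgRegret f (bitReward B hB a₁ b) (bitPolicy B a₁ a₂ b) s x n T ∂fairCoins := by
  classical
  simp only [avgRegret_bitReward B hB a₁ a₂ f s x n ha]
  rw [integral_const_mul, integral_finsetSum _ fun t _ => integrable_mistake B hB a₁ f s x n t]
  refine mul_le_mul_of_nonneg_left ?_ (by positivity)
  rw [visitedCount_eq_card hd, mul_comm, ← nsmul_eq_mul, ← Finset.sum_const]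
  refine le_trans (Finset.sum_le_sum fun t ht => ?_) (Finset.sum_le_sum_of_subset_of_nonneg
    (Finset.filter_subset (IsFirstVisit B x) _) fun t _ _ => ?_)
  · exact (integral_mistake_of_isFirstVisit B hB a₁ f s x n hd (Finset.mem_filter.1 ht).2).ge
  · exact integral_nonneg fun b => mistake_nonneg B hB a₁ f s x n b t

end Memorization

/-- Suppose that a rule is consistent under a process outside of `C₂`. It is consistent for every
fixed sequence of bits, hence also if the bits are random. But then the expected regret at a
stopping time at which linearly many sets have been visited is bounded from below. -/
theorem COblivious_subset_C2 {𝓧 : Type u} {A : Type v} [MeasurableSpace 𝓧] [MeasurableSpace A]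
    [MeasurableSingletonClass A] (hA : ∃ a₁ a₂ : A, a₁ ≠ a₂) :
    COblivious.{u, v, w} 𝓧 A ⊆ C2 𝓧 := by
  classical
  rintro μ ⟨f, hf⟩
  obtain ⟨a₁, a₂, ha⟩ := hA
  by_contra hC2
  obtain ⟨B, hB, hd, ε, hε, hL⟩ := exists_frequent_visits_of_notMem_C2 hC2
  choose L hL using hL
  -- A stopping time at which linearly many sets have been visited, if there is one in `[K, L K]`.
  have hex : ∀ K (x : ℕ → 𝓧), ∃ T, K ≤ T ∧ (ε * T ≤ visitedCount B x T ∨ L K < T) := fun K x =>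
    ⟨max K (L K + 1), le_max_left _ _, Or.inr (Nat.lt_of_succ_le (le_max_right _ _))⟩
  set τ : ℕ → (ℕ → 𝓧) → ℕ := fun K x => Nat.find (hex K x) with hτ
  have hvis : ∀ T : ℕ, MeasurableSet {x : ℕ → 𝓧 | ε * T ≤ visitedCount B x T} := fun T =>
    measurableSet_le measurable_const
      ((measurable_of_countable (Nat.cast : ℕ → ℝ)).comp (measurable_visitedCount hB hd T))
  have hτm : ∀ K, Measurable (τ K) := fun K => by
    refine measurable_find (hex K) fun T => ?_
    by_cases h1 : K ≤ T <;> by_cases h2 : L K < T <;> simp only [h1, h2, or_true, or_false,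
      true_and, false_and]
    · exact .univ
    · exact hvis T
    · exact .empty
    · exact .empty
  -- Random bits are added to the probability space.
  set Z := (ℕ → 𝓧) × f.Seed × (ℕ → I)
  set P : Measure ((ℕ → Bool) × Z) := fairCoins.prod (runLaw μ f) with hP
  have hreg := measurable_avgRegret f (bitReward B hB a₁) (measurable_bitReward hB a₁)
    (bitPolicy B a₁ a₂) (measurable_bitPolicy hB a₁ a₂)
  set g : ℕ → (ℕ → Bool) × Z → ℝ := fun K z => avgRegret f (bitReward B hB a₁ z.1)
    (bitPolicy B a₁ a₂ z.1) z.2.2.1 z.2.1 z.2.2.2 (τ K z.2.1) with hg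
  have hgm : ∀ K, Measurable (g K) := fun K => by
    have h : Measurable fun p : ℕ × ((ℕ → Bool) × Z) => avgRegret f (bitReward B hB a₁ p.2.1)
        (bitPolicy B a₁ a₂ p.2.1) p.2.2.2.1 p.2.2.1 p.2.2.2.2 p.1 :=
      measurable_from_prod_countable_right fun T => hreg T
    exact h.comp (((hτm K).comp (measurable_fst.comp measurable_snd)).prodMk measurable_id)
  have hgb : ∀ K z, |g K z| ≤ 1 := fun K z => abs_avgRegret_le_one _ _ _ _ _ _ _
  have hlim : ∀ δ > 0, ∀ᵐ z ∂P, ∀ᶠ K in atTop, g K z ≤ δ := by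
    intro δ hδ
    have h : ∀ᵐ z ∂P, ∀ᶠ T in atTop, avgRegret f (bitReward B hB a₁ z.1)
        (bitPolicy B a₁ a₂ z.1) z.2.2.1 z.2.1 z.2.2.2 T ≤ δ := by
      rw [hP, Measure.ae_prod_iff_ae_ae]
      · exact ae_of_all _ fun b => (hf (bitReward B hB a₁ b)).ae_eventually_avgRegret_le
          ((measurable_bitPolicy hB a₁ a₂).comp (measurable_const.prodMk measurable_id)) hδ
      · simp only [eventually_atTop, Set.ofPred_exists, Set.ofPred_forall]
        exact .iUnion fun N => .iInter fun T => .iInter fun _ =>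
          measurableSet_le (hreg T) measurable_const
    filter_upwards [h] with z hz
    obtain ⟨N, hN⟩ := eventually_atTop.1 hz
    exact eventually_atTop.2 ⟨N, fun K hK =>
      hN _ (hK.trans (Nat.find_spec (hex K z.2.1)).1)⟩
  have hev := eventually_integral_le_of_ae_eventually_le hgm hgb hlim
    (show 0 < ε * ε / 4 by positivity)
  obtain ⟨K, hK, hK1⟩ := (hev.and (eventually_ge_atTop 1)).exists
  set E : Set (ℕ → 𝓧) := {x | ε * τ K x ≤ visitedCount B x (τ K x)} with hE
  have hEm : MeasurableSet E := by
    have h : Measurable fun p : ℕ × (ℕ → 𝓧) => (visitedCount B p.2 p.1 : ℝ) - ε * p.1 :=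
      measurable_from_prod_countable_right fun T =>
        Measurable.sub_const ((measurable_of_countable (Nat.cast : ℕ → ℝ)).comp
          (measurable_visitedCount hB hd T)) (ε * T)
    have h' := h.comp ((hτm K).prodMk measurable_id)
    have : E = {x | 0 ≤ (visitedCount B x (τ K x) : ℝ) - ε * τ K x} := by
      ext x; simp [hE]
    rw [this]
    exact measurableSet_le measurable_const h'
  have hEμ : ENNReal.ofReal ε ≤ (μ : Measure (ℕ → 𝓧)) E := by
    refine (hL K).trans (measure_mono ?_)
    rintro x ⟨T, h1, h2, h3, -⟩
    rcases (Nat.find_spec (hex K x)).2 with h | h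
    · exact h
    · exact absurd (Nat.find_min' (hex K x) ⟨h1, Or.inl h3⟩) (by omega)
  have hint : Integrable (g K) P := Integrable.of_bound (hgm K).aestronglyMeasurable 1
    (ae_of_all _ (hgb K))
  have hlow : ∫ z, (Prod.fst ⁻¹' E).indicator (fun _ => ε / 2) z ∂runLaw μ f ≤ ∫ z, g K z ∂P := by
    rw [hP, integral_prod_symm _ hint]
    refine integral_mono ((integrable_const _).indicator (measurable_fst hEm))
      hint.integral_prod_right fun z => ?_
    have h1 := half_visitedCount_le_integral B hB a₁ a₂ f z.2.1 z.1 z.2.2 hd ha (τ K z.1)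
    refine le_trans ?_ h1
    have hpos : (0 : ℝ) < τ K z.1 := by
      exact_mod_cast hK1.trans (Nat.find_spec (hex K z.1)).1
    by_cases hz : z.1 ∈ E
    · rw [Set.indicator_of_mem (show z ∈ Prod.fst ⁻¹' E from hz), one_div,
        le_inv_mul_iff₀ hpos]
      have : ε * τ K z.1 ≤ visitedCount B z.1 (τ K z.1) := hz
      linarith
    · rw [Set.indicator_of_notMem (show z ∉ Prod.fst ⁻¹' E from hz)]
      positivity
  rw [integral_indicator_const _ (measurable_fst hEm), smul_eq_mul] at hlow
  have hreal : ε ≤ (runLaw μ f).real (Prod.fst ⁻¹' E) := by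
    rw [measureReal_def, measurePreserving_fst.measure_preimage hEm.nullMeasurableSet]
    exact (ENNReal.ofReal_le_iff_le_toReal (measure_ne_top _ _)).1 hEμ
  nlinarith

/-! ### Cells of a non-atomic probability measure -/

/-- The quantile sets of a non-atomic probability measure: `D a` has measure `a`. They are the
preimages of half-lines under a measurable injection to the real line; as there are no atoms, the
distribution function of the image measure is continuous and takes all values between `0` and
`1`. -/
theorem exists_quantile_sets {𝓧 : Type u} [TopologicalSpace 𝓧] [TopologicalSpace.MetrizableSpace 𝓧]
    [TopologicalSpace.SeparableSpace 𝓧] [MeasurableSpace 𝓧] [BorelSpace 𝓧]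
    (ν : Measure 𝓧) [IsProbabilityMeasure ν] (hν : ∀ x, ν {x} = 0) :
    ∃ D : ℝ → Set 𝓧, (∀ a, MeasurableSet (D a)) ∧ ∀ a b, 0 < a → a < b → b < 1 →
      D a ⊆ D b ∧ ν (D b \ D a) = ENNReal.ofReal (b - a) := by
  let _ := TopologicalSpace.metrizableSpaceMetric 𝓧
  have : SecondCountableTopology 𝓧 := UniformSpace.secondCountable_of_separable 𝓧
  obtain ⟨e, he⟩ := exists_measurableEmbedding_real (ℕ → Bool)
  set φ : 𝓧 → ℝ := e ∘ MeasurableSpace.mapNatBool 𝓧 with hφ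
  have hφm : Measurable φ := he.measurable.comp (MeasurableSpace.measurable_mapNatBool 𝓧)
  have hφi : Function.Injective φ := he.injective.comp (MeasurableSpace.injective_mapNatBool 𝓧)
  set l := ν.map φ with hl
  have : IsProbabilityMeasure l := Measure.isProbabilityMeasure_map hφm.aemeasurable
  have hl0 : ∀ y, l {y} = 0 := by
    intro y
    rw [hl, Measure.map_apply hφm (measurableSet_singleton y)]
    by_cases h : ∃ x, φ x = y
    · obtain ⟨x, rfl⟩ := h
      refine measure_mono_null (fun z hz => ?_) (hν x)
      exact hφi hz
    · rw [show φ ⁻¹' {y} = ∅ from Set.eq_empty_of_forall_notMem fun x hx => h ⟨x, hx⟩]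
      exact measure_empty
  have hcont : Continuous (cdf l) := by
    refine continuous_iff_continuousAt.2 fun x => ?_
    rw [(monotone_cdf l).continuousAt_iff_leftLim_eq_rightLim, StieltjesFunction.rightLim_eq]
    have h := (cdf l).measure_singleton x
    rw [measure_cdf, hl0, eq_comm, ENNReal.ofReal_eq_zero] at h
    exact le_antisymm ((monotone_cdf l).leftLim_le le_rfl) (by linarith)
  have hq : ∀ a, ∃ y, 0 < a → a < 1 → cdf l y = a := by
    intro a
    by_cases ha : 0 < a ∧ a < 1
    · obtain ⟨y₁, h1⟩ := ((tendsto_cdf_atBot l).eventually (gt_mem_nhds ha.1)).exists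
      obtain ⟨y₂, h2⟩ := ((tendsto_cdf_atTop l).eventually (lt_mem_nhds ha.2)).exists
      obtain ⟨y, hy⟩ := mem_range_of_exists_le_of_exists_ge hcont ⟨y₁, h1.le⟩ ⟨y₂, h2.le⟩
      exact ⟨y, fun _ _ => hy⟩
    · exact ⟨0, fun h h' => absurd ⟨h, h'⟩ ha⟩
  choose q hq using hq
  refine ⟨fun a => φ ⁻¹' Set.Iic (q a), fun a => hφm measurableSet_Iic, fun a b ha hab hb => ?_⟩
  have hqa := hq a ha (hab.trans hb)
  have hqb := hq b (ha.trans hab) hb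
  have hle : q a ≤ q b := by
    by_contra h
    have := monotone_cdf l (not_le.1 h).le
    linarith
  refine ⟨Set.preimage_mono (Set.Iic_subset_Iic.2 hle), ?_⟩
  rw [← Set.preimage_sdiff, ← Measure.map_apply hφm (measurableSet_Iic.diff measurableSet_Iic),
    Set.Iic_sdiff_Iic, ← hl]
  rw [← measure_cdf l, StieltjesFunction.measure_Ioc, hqa, hqb]

/-- The type of the window of times `2 ^ u ≤ τ < 2 ^ (u + 1)`. Every type is taken infinitely
often. -/
def winType (u : ℕ) : ℕ := (Nat.unpair u).1

theorem winType_le (u : ℕ) : winType u ≤ u := Nat.unpair_left_le u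

theorem exists_le_winType_eq (i N : ℕ) : ∃ u, N ≤ u ∧ winType u = i :=
  ⟨Nat.pair i N, Nat.right_le_pair i N, by rw [winType, Nat.unpair_pair]⟩

/-- The length of a cycle in window `u`; the window consists of `2 ^ winType u` cycles. -/
def cycleLen (u : ℕ) : ℕ := 2 ^ (u - winType u)

theorem cycleLen_pos (u : ℕ) : 0 < cycleLen u := by unfold cycleLen; positivity

theorem two_pow_winType_mul_cycleLen (u : ℕ) : 2 ^ winType u * cycleLen u = 2 ^ u := by
  rw [cycleLen, ← pow_add, Nat.add_sub_cancel' (winType_le u)]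

theorem cycleLen_le (u : ℕ) : cycleLen u ≤ 2 ^ u :=
  Nat.pow_le_pow_right two_pos (Nat.sub_le _ _)

/-- Disjoint sets `block i`, one for each type of window, and inside of `block i` for each window
of type `i` a system of disjoint cells with the same measure, one for each position in a cycle.
Since `cycleLen u = 2 ^ (u - i)`, the cells of a window of type `i` fill a set of measure
`1 / 2 ^ (i + 2)`, whatever the window.
Nothing is assumed about `cell u w` for `cycleLen u ≤ w`. -/
structure CellSystem {𝓧 : Type u} [MeasurableSpace 𝓧] (ν : Measure 𝓧) where
  /-- The set of contexts that occur in windows of the given type. -/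
  block : ℕ → Set 𝓧
  /-- The set from which the context of the given window and position is drawn. -/
  cell : ℕ → ℕ → Set 𝓧
  measurableSet_block : ∀ i, MeasurableSet (block i)
  measurableSet_cell : ∀ u w, MeasurableSet (cell u w)
  disjoint_block : Pairwise (Function.onFun Disjoint block)
  cell_subset : ∀ u w, w < cycleLen u → cell u w ⊆ block (winType u)
  disjoint_cell : ∀ u w w', w < w' → w' < cycleLen u → Disjoint (cell u w) (cell u w')
  measure_cell : ∀ u w, w < cycleLen u → ν (cell u w) = (2 ^ (u + 2))⁻¹

/-- The blocks are the quantile ranges from `β i = 1 / 2 ^ (i + 2)` to `2 * β i`, and the cells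
divide them evenly. -/
theorem nonempty_cellSystem {𝓧 : Type u} [TopologicalSpace 𝓧]
    [TopologicalSpace.MetrizableSpace 𝓧] [TopologicalSpace.SeparableSpace 𝓧] [MeasurableSpace 𝓧]
    [BorelSpace 𝓧] (ν : Measure 𝓧) [IsProbabilityMeasure ν] (hν : ∀ x, ν {x} = 0) :
    Nonempty (CellSystem ν) := by
  obtain ⟨D, hDm, hD⟩ := exists_quantile_sets ν hν
  have hsub : ∀ a b, 0 < a → a ≤ b → b < 1 → D a ⊆ D b := fun a b ha hab hb => by
    rcases hab.eq_or_lt with rfl | h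
    · exact subset_rfl
    · exact (hD a b ha h hb).1
  have hdisj : ∀ a b a' b', 0 < b → b ≤ a' → a' < 1 → Disjoint (D b \ D a) (D b' \ D a') :=
    fun a b a' b' hb h h1 => Set.disjoint_left.2 fun x hx hx' => hx'.2 (hsub b a' hb h h1 hx.1)
  set β : ℕ → ℝ := fun i => (1 / 2) ^ (i + 2) with hβ
  have hβ0 : ∀ i, 0 < β i := fun i => by positivity
  have hβ1 : ∀ i, 2 * β i < 1 := fun i => by
    have : (1 / 2 : ℝ) ^ i ≤ 1 := pow_le_one₀ (by norm_num) (by norm_num)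
    simp only [hβ, pow_add]; linarith
  have hβm : ∀ i j, i < j → 2 * β j ≤ β i := fun i j h => by
    have : (1 / 2 : ℝ) ^ (j + 2) ≤ (1 / 2) ^ (i + 3) :=
      pow_le_pow_of_le_one (by norm_num) (by norm_num) (by omega)
    simp only [hβ]
    rw [pow_succ (1 / 2 : ℝ) (i + 2)] at this
    linarith
  have hp : ∀ u, (0 : ℝ) < cycleLen u := fun u => by exact_mod_cast cycleLen_pos u
  -- The end points of the cells.
  set γ : ℕ → ℕ → ℝ := fun u w => β (winType u) * (1 + (w : ℝ) / cycleLen u) with hγ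
  have hγ0 : ∀ u w, β (winType u) ≤ γ u w := fun u w => by
    have : (0 : ℝ) ≤ (w : ℝ) / cycleLen u := by positivity
    simp only [hγ]; nlinarith [hβ0 (winType u)]
  have hγ1 : ∀ u w, w ≤ cycleLen u → γ u w ≤ 2 * β (winType u) := fun u w hw => by
    have : (w : ℝ) / cycleLen u ≤ 1 := (div_le_one (hp u)).2 (by exact_mod_cast hw)
    simp only [hγ]; nlinarith [hβ0 (winType u)]
  have hγm : ∀ u w w', w ≤ w' → γ u w ≤ γ u w' := fun u w w' h => by
    have : (w : ℝ) / cycleLen u ≤ (w' : ℝ) / cycleLen u := by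
      have := hp u; gcongr
    simp only [hγ]; nlinarith [hβ0 (winType u)]
  refine ⟨⟨fun i => D (2 * β i) \ D (β i), fun u w => D (γ u (w + 1)) \ D (γ u w),
    fun i => (hDm _).diff (hDm _), fun u w => (hDm _).diff (hDm _), ?_, ?_, ?_, ?_⟩⟩
  · intro i j hij
    rcases hij.lt_or_gt with h | h
    · exact (hdisj _ _ _ _ (by linarith [hβ0 j]) (hβm i j h)
        (by linarith [hβ1 i, hβ0 i])).symm
    · exact hdisj _ _ _ _ (by linarith [hβ0 i]) (hβm j i h) (by linarith [hβ1 j, hβ0 j])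
  · intro u w hw
    have h1 := hγ1 u (w + 1) hw
    have h2 := hγ1 u w hw.le
    exact Set.sdiff_subset_sdiff (hsub _ _ ((hβ0 _).trans_le (hγ0 u (w + 1))) h1 (hβ1 _))
      (hsub _ _ (hβ0 _) (hγ0 u w) (h2.trans_lt (hβ1 _)))
  · intro u w w' h hw'
    exact hdisj _ _ _ _ ((hβ0 _).trans_le (hγ0 u (w + 1))) (hγm u _ _ h)
      ((hγ1 u w' hw'.le).trans_lt (hβ1 _))
  · intro u w hw
    have h1 : γ u (w + 1) - γ u w = (1 / 2) ^ (u + 2) := by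
      have h2 : (cycleLen u : ℝ) = 2 ^ (u - winType u) := by simp [cycleLen]
      have h3 : (1 / 2 : ℝ) ^ (u + 2) = (1 / 2) ^ (winType u + 2) * (1 / cycleLen u) := by
        rw [h2, ← one_div_pow, ← pow_add]
        congr 1
        have := winType_le u
        omega
      have := hp u
      simp only [hγ, hβ]
      rw [h3]
      push_cast
      field_simp
      ring
    have hpos : (0 : ℝ) < (1 / 2) ^ (u + 2) := by positivity
    rw [(hD _ _ ((hβ0 _).trans_le (hγ0 u w)) (by linarith)
      ((hγ1 u (w + 1) hw).trans_lt (hβ1 _))).2, h1, one_div, inv_pow,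
      ENNReal.ofReal_inv_of_pos (by positivity), ENNReal.ofReal_pow (by norm_num)]
    simp

/-! ### A process that repeats a fresh sample cyclically in every window -/

/-- The position in the cycle at time `τ`, i.e. in round `τ - 1`. -/
def cyclePos (τ : ℕ) : ℕ := τ % cycleLen (Nat.log 2 τ)

theorem cyclePos_lt (τ : ℕ) : cyclePos τ < cycleLen (Nat.log 2 τ) :=
  Nat.mod_lt _ (cycleLen_pos _)

/-- The time in the first cycle of the window of `τ` with the same position. -/
def firstOccurrence (τ : ℕ) : ℕ := 2 ^ Nat.log 2 τ + cyclePos τ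

theorem log_two_pow_add {u j : ℕ} (hj : j < 2 ^ u) : Nat.log 2 (2 ^ u + j) = u := by
  refine (Nat.log_eq_iff (Or.inr ⟨one_lt_two, by positivity⟩)).2 ⟨by omega, ?_⟩
  rw [pow_succ]; omega

theorem cyclePos_two_pow_add {u j : ℕ} (hj : j < 2 ^ u) :
    cyclePos (2 ^ u + j) = j % cycleLen u := by
  rw [cyclePos, log_two_pow_add hj, ← two_pow_winType_mul_cycleLen, mul_comm, Nat.mul_add_mod]

theorem log_firstOccurrence (τ : ℕ) : Nat.log 2 (firstOccurrence τ) = Nat.log 2 τ :=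
  log_two_pow_add ((cyclePos_lt τ).trans_le (cycleLen_le _))

theorem cyclePos_firstOccurrence (τ : ℕ) : cyclePos (firstOccurrence τ) = cyclePos τ := by
  rw [firstOccurrence, cyclePos_two_pow_add ((cyclePos_lt τ).trans_le (cycleLen_le _)),
    Nat.mod_eq_of_lt (cyclePos_lt τ)]

namespace CellSystem

variable {𝓧 : Type u} [MeasurableSpace 𝓧] {ν : Measure 𝓧} [IsProbabilityMeasure ν]
  (c : CellSystem ν)

/-- The law of the context at time `τ`: the measure `ν` conditioned on the cell. -/
noncomputable def drawLaw (τ : ℕ) : Measure 𝓧 := ν[|c.cell (Nat.log 2 τ) (cyclePos τ)]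

instance (τ : ℕ) : IsProbabilityMeasure (c.drawLaw τ) := by
  refine cond_isProbabilityMeasure ?_
  rw [c.measure_cell _ _ (cyclePos_lt τ)]
  exact ENNReal.inv_ne_zero.2 (by finiteness)

/-- Independent draws, one for each time. Only those at first occurrences are used. -/
noncomputable def drawsLaw : Measure (ℕ → 𝓧) := Measure.infinitePi c.drawLaw

instance : IsProbabilityMeasure c.drawsLaw := by unfold drawsLaw; infer_instance

theorem measurable_repeat :
    Measurable fun (z : ℕ → 𝓧) (t : ℕ) => z (firstOccurrence (t + 1)) :=
  measurable_pi_iff.2 fun _ => measurable_pi_apply _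

/-- The process in which window `u` consists of `2 ^ winType u` cycles of length `cycleLen u`
through the same fresh independent contexts, one from each cell. -/
noncomputable def process : ContextProcess 𝓧 :=
  ⟨c.drawsLaw.map fun z t => z (firstOccurrence (t + 1)),
    Measure.isProbabilityMeasure_map measurable_repeat.aemeasurable⟩

/-- Repetitions of a draw occur in the same window at the same position, hence in the same cell. -/
theorem ae_process_mem_cell : ∀ᵐ x ∂(c.process : Measure (ℕ → 𝓧)),
    ∀ t, x t ∈ c.cell (Nat.log 2 (t + 1)) (cyclePos (t + 1)) := by
  refine ae_all_iff.2 fun t => ?_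
  refine (ae_map_iff measurable_repeat.aemeasurable
    (measurable_pi_apply t (c.measurableSet_cell _ _))).2 ?_
  have h : ∀ᵐ y ∂c.drawLaw (firstOccurrence (t + 1)),
      y ∈ c.cell (Nat.log 2 (t + 1)) (cyclePos (t + 1)) := by
    unfold drawLaw
    rw [log_firstOccurrence, cyclePos_firstOccurrence]
    exact ae_cond_mem (c.measurableSet_cell _ _)
  exact (measurePreserving_eval_infinitePi c.drawLaw _).quasiMeasurePreserving.ae h

end CellSystem

/-! ### The cyclic process is not in `C₄` -/

namespace CellSystem

variable {𝓧 : Type u} [MeasurableSpace 𝓧] {ν : Measure 𝓧} (c : CellSystem ν)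

theorem cyclePos_lt_of_log_eq {τ u : ℕ} (h : Nat.log 2 τ = u) : cyclePos τ < cycleLen u :=
  h ▸ cyclePos_lt τ

/-- Contexts at different positions of the same window are different. -/
theorem ne_of_cyclePos_ne {x : ℕ → 𝓧}
    (hx : ∀ t, x t ∈ c.cell (Nat.log 2 (t + 1)) (cyclePos (t + 1))) {s t : ℕ}
    (hlog : Nat.log 2 (s + 1) = Nat.log 2 (t + 1)) (hne : cyclePos (s + 1) ≠ cyclePos (t + 1)) :
    x s ≠ x t := by
  intro heq
  have h1 := hx s
  have h2 := hx t
  rw [hlog, heq] at h1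
  have hs := cyclePos_lt_of_log_eq hlog
  have ht := cyclePos_lt (t + 1)
  rcases hne.lt_or_gt with h | h
  · exact Set.disjoint_left.1 (c.disjoint_cell _ _ _ h ht) h1 h2
  · exact Set.disjoint_left.1 (c.disjoint_cell _ _ _ h hs) h2 h1

/-- In a window of type `i` the periods of `firstTimes i` are the cycles. -/
theorem mem_firstTimes {x : ℕ → 𝓧}
    (hx : ∀ t, x t ∈ c.cell (Nat.log 2 (t + 1)) (cyclePos (t + 1))) {t u : ℕ}
    (h1 : 2 ^ u ≤ t + 1) (h2 : t + 1 < 2 ^ (u + 1)) :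
    t ∈ firstTimes (winType u) x := by
  obtain ⟨j, hj⟩ := Nat.exists_eq_add_of_le h1
  have hju : j < 2 ^ u := by rw [pow_succ] at h2; omega
  have hN := cycleLen_pos u
  set N := cycleLen u with hNdef
  set v := j / N with hv
  have hmul := two_pow_winType_mul_cycleLen u
  have hvm : v < 2 ^ winType u := by
    rw [hv, Nat.div_lt_iff_lt_mul hN, hmul]; exact hju
  have hdm : v * N + j % N = j := by rw [mul_comm]; exact Nat.div_add_mod j N
  have hml := Nat.mod_lt j hN
  have e1 : scaleTime (winType u) (u * 2 ^ winType u + v) = 2 ^ u + v * N :=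
    scaleTime_add _ _ _ hvm (winType_le u)
  have e2 : scaleTime (winType u) (u * 2 ^ winType u + v + 1) = 2 ^ u + (v + 1) * N := by
    rcases Nat.lt_or_ge (v + 1) (2 ^ winType u) with h | h
    · exact scaleTime_add _ _ _ h (winType_le u)
    · have hveq : v + 1 = 2 ^ winType u := by omega
      rw [add_assoc, hveq, hmul, ← Nat.succ_mul, scaleTime_mul, pow_succ]
      omega
  refine ⟨u * 2 ^ winType u + v, ?_, ?_, fun s hs hs1 => ?_⟩
  · rw [e1, hj]; omega
  · rw [e2, hj, add_mul, one_mul]; omega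
  · rw [e1] at hs1
    obtain ⟨l, hl⟩ := Nat.exists_eq_add_of_le ((Nat.le_add_right _ _).trans hs1)
    have hlu : l < 2 ^ u := by omega
    refine c.ne_of_cyclePos_ne hx ?_ ?_
    · rw [hl, hj, log_two_pow_add hlu, log_two_pow_add hju]
    · rw [hl, hj, cyclePos_two_pow_add hlu, cyclePos_two_pow_add hju, ← hNdef]
      have hdl : l / N * N + l % N = l := by rw [mul_comm]; exact Nat.div_add_mod l N
      have hdv : l / N = v := by
        refine le_antisymm (Nat.div_le_div_right (by omega)) ?_
        rw [Nat.le_div_iff_mul_le hN]; omega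
      rw [hdv] at hdl
      omega

variable [IsProbabilityMeasure ν]

/-- For the blocks of the cell system all times in windows of type `i` are counted by `scaleFreq i`,
and at the end of such a window they are half of the past. -/
theorem process_notMem_C4 : c.process ∉ C4 𝓧 := by
  intro h
  have hlim := h c.block c.measurableSet_block c.disjoint_block
  have hlow : ∀ i, ENNReal.ofReal (1 / 2) ≤
      ∫⁻ x, scaleFreq i (c.block i) x ∂(c.process : Measure (ℕ → 𝓧)) := by
    intro i
    have hae : ∀ᵐ x ∂(c.process : Measure (ℕ → 𝓧)),
        ENNReal.ofReal (1 / 2) ≤ scaleFreq i (c.block i) x := by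
      filter_upwards [c.ae_process_mem_cell] with x hx
      refine le_scaleFreq_of_frequently (frequently_atTop.2 fun N => ?_)
      obtain ⟨u, hu, rfl⟩ := exists_le_winType_eq i N
      have hpos : 0 < 2 ^ u := by positivity
      refine ⟨2 ^ (u + 1) - 1, ?_, Finset.Ico (2 ^ u - 1) (2 ^ (u + 1) - 1), ?_, ?_, ?_⟩
      · have := Nat.lt_two_pow_self (n := u)
        rw [pow_succ]; omega
      · intro t ht
        exact Finset.mem_range.2 (Finset.mem_Ico.1 ht).2
      · intro t ht
        obtain ⟨h1, h2⟩ := Finset.mem_Ico.1 ht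
        refine ⟨c.mem_firstTimes hx (by omega) (by omega), ?_⟩
        have hlog : Nat.log 2 (t + 1) = u := by
          refine (Nat.log_eq_iff (Or.inr ⟨one_lt_two, by omega⟩)).2 ⟨by omega, by omega⟩
        have := hx t
        rw [hlog] at this
        exact c.cell_subset _ _ (cyclePos_lt_of_log_eq hlog) this
      · rw [Nat.card_Ico, show 2 ^ (u + 1) - 1 - (2 ^ u - 1) = 2 ^ u by rw [pow_succ]; omega,
          Nat.cast_sub (by rw [pow_succ]; omega)]
        push_cast
        rw [pow_succ]
        linarith
    calc ENNReal.ofReal (1 / 2) = ∫⁻ _, ENNReal.ofReal (1 / 2)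
          ∂(c.process : Measure (ℕ → 𝓧)) := by simp
      _ ≤ _ := lintegral_mono_ae hae
  have h0 := ge_of_tendsto' hlim hlow
  simp at h0

end CellSystem

/-! ### The cyclic process is in `C₂` -/

section Hits

variable {𝓧 : Type u}

/-- The number of distinct draws of window `u` that lie in `D`. -/
noncomputable def hits (D : Set 𝓧) (u : ℕ) (z : ℕ → 𝓧) : ℝ :=
  ∑ r ∈ Finset.Ico (2 ^ u) (2 ^ u + cycleLen u), D.indicator (fun _ => (1 : ℝ)) (z r)

/-- Up to time `T` the members of `C` with index at least `K` are visited by distinct draws, which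
belong to the windows up to `Nat.log 2 T`. -/
theorem visitedCount_repeat_le {C : ℕ → Set 𝓧} (hC : Pairwise (Function.onFun Disjoint C))
    (K T : ℕ) (z : ℕ → 𝓧) :
    (visitedCount C (fun t => z (firstOccurrence (t + 1))) T : ℝ) ≤
      K + ∑ u ∈ Finset.range (Nat.log 2 T + 1), hits (⋃ k, ⋃ _ : K ≤ k, C k) u z := by
  classical
  set D := ⋃ k, ⋃ _ : K ≤ k, C k with hD
  set F := (Finset.range (Nat.log 2 T + 1)).biUnion fun u =>
    Finset.filter (fun r => z r ∈ D) (Finset.Ico (2 ^ u) (2 ^ u + cycleLen u)) with hF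
  have hk : ∀ r, ∃ k, ∀ k', z r ∈ C k' → k' = k := by
    intro r
    by_cases h : ∃ k, z r ∈ C k
    · obtain ⟨k, hk⟩ := h
      refine ⟨k, fun k' hk' => ?_⟩
      by_contra hne
      exact Set.disjoint_left.1 (hC hne) hk' hk
    · exact ⟨0, fun k' hk' => absurd ⟨k', hk'⟩ h⟩
  choose κ hκ using hk
  have hsub : {k : ℕ | ∃ t < T, z (firstOccurrence (t + 1)) ∈ C k} ⊆
      ((Finset.range K ∪ F.image κ : Finset ℕ) : Set ℕ) := by
    rintro k ⟨t, ht, hk⟩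
    rw [Finset.mem_coe, Finset.mem_union]
    rcases Nat.lt_or_ge k K with h | h
    · exact Or.inl (Finset.mem_range.2 h)
    · refine Or.inr (Finset.mem_image.2 ⟨firstOccurrence (t + 1), ?_, (hκ _ k hk).symm⟩)
      refine Finset.mem_biUnion.2 ⟨Nat.log 2 (t + 1), ?_, Finset.mem_filter.2 ⟨?_, ?_⟩⟩
      · exact Finset.mem_range.2 (Nat.lt_succ_of_le (Nat.log_mono_right ht))
      · exact Finset.mem_Ico.2 ⟨Nat.le_add_right _ _,
          Nat.add_lt_add_left (cyclePos_lt _) _⟩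
      · exact Set.mem_iUnion₂.2 ⟨k, h, hk⟩
  have hcard : visitedCount C (fun t => z (firstOccurrence (t + 1))) T ≤
      K + ∑ u ∈ Finset.range (Nat.log 2 T + 1),
        (Finset.filter (fun r => z r ∈ D) (Finset.Ico (2 ^ u) (2 ^ u + cycleLen u))).card := by
    unfold visitedCount
    refine (Set.ncard_le_ncard hsub (Finset.finite_toSet _)).trans ?_
    rw [Set.ncard_coe_finset]
    refine (Finset.card_union_le _ _).trans ?_
    rw [Finset.card_range]
    exact Nat.add_le_add_left (Finset.card_image_le.trans Finset.card_biUnion_le) _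
  refine (Nat.cast_le.2 hcard).trans (le_of_eq ?_)
  push_cast
  congr 1
  refine Finset.sum_congr rfl fun u _ => ?_
  rw [hits, Finset.card_filter]
  push_cast
  rfl

end Hits

namespace CellSystem

variable {𝓧 : Type u} [MeasurableSpace 𝓧] {ν : Measure 𝓧} [IsProbabilityMeasure ν]
  (c : CellSystem ν)

/-- A draw of window `u` has the density `2 ^ (u + 2)` on its cell, and the cells of a window are
disjoint. -/
theorem integral_hits_le {D : Set 𝓧} (hD : MeasurableSet D) (u : ℕ) :
    ∫ z, hits D u z ∂c.drawsLaw ≤ 2 ^ (u + 2) * ν.real D := by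
  have hm : ∀ r, Measurable fun z : ℕ → 𝓧 => D.indicator (fun _ => (1 : ℝ)) (z r) := fun r =>
    (measurable_const.indicator hD).comp (measurable_pi_apply r)
  have hint : ∀ r, Integrable (fun z : ℕ → 𝓧 => D.indicator (fun _ => (1 : ℝ)) (z r)) c.drawsLaw :=
    fun r => Integrable.of_bound (hm r).aestronglyMeasurable 1 (ae_of_all _ fun z => by
      by_cases h : z r ∈ D <;> simp [h])
  unfold hits
  rw [integral_finsetSum _ fun r _ => hint r]
  have hterm : ∀ r ∈ Finset.Ico (2 ^ u) (2 ^ u + cycleLen u),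
      ∫ z, D.indicator (fun _ => (1 : ℝ)) (z r) ∂c.drawsLaw =
        2 ^ (u + 2) * ν.real (c.cell u (r - 2 ^ u) ∩ D) := by
    intro r hr
    obtain ⟨h1, h2⟩ := Finset.mem_Ico.1 hr
    obtain ⟨w, rfl⟩ := Nat.exists_eq_add_of_le h1
    have hw : w < cycleLen u := by omega
    have hwu := hw.trans_le (cycleLen_le u)
    have hmp := measurePreserving_eval_infinitePi c.drawLaw (2 ^ u + w)
    have : ∫ z, D.indicator (fun _ => (1 : ℝ)) (z (2 ^ u + w)) ∂c.drawsLaw =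
        ∫ y, D.indicator (fun _ => (1 : ℝ)) y ∂c.drawLaw (2 ^ u + w) := by
      rw [← hmp.map_eq]
      exact (integral_map hmp.measurable.aemeasurable
        (measurable_const.indicator hD).aestronglyMeasurable).symm
    rw [this, integral_indicator_const _ hD, smul_eq_mul, mul_one, drawLaw, log_two_pow_add hwu,
      cyclePos_two_pow_add hwu, Nat.mod_eq_of_lt hw, measureReal_def,
      cond_apply (c.measurableSet_cell _ _), c.measure_cell _ _ hw, inv_inv, ENNReal.toReal_mul,
      Nat.add_sub_cancel_left]
    simp [measureReal_def]
  rw [Finset.sum_congr rfl hterm, ← Finset.mul_sum]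
  refine mul_le_mul_of_nonneg_left ?_ (by positivity)
  rw [← measureReal_biUnion_finset]
  · exact measureReal_mono (Set.iUnion₂_subset fun r _ => Set.inter_subset_right)
  · intro r hr r' hr' hne
    obtain ⟨h1, h2⟩ := Finset.mem_Ico.1 hr
    obtain ⟨h1', h2'⟩ := Finset.mem_Ico.1 hr'
    refine Disjoint.mono Set.inter_subset_left Set.inter_subset_left ?_
    rcases hne.lt_or_gt with h | h
    · exact c.disjoint_cell u _ _ (by omega) (by omega)
    · exact (c.disjoint_cell u _ _ (by omega) (by omega)).symm
  · exact fun r _ => (c.measurableSet_cell _ _).inter hD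

theorem variance_hits_le {D : Set 𝓧} (hD : MeasurableSet D) (u : ℕ) :
    variance (hits D u) c.drawsLaw ≤ 2 ^ u := by
  have hm : Measurable (D.indicator (fun _ => (1 : ℝ))) := measurable_const.indicator hD
  have hm' : ∀ r, Measurable fun z : ℕ → 𝓧 => D.indicator (fun _ => (1 : ℝ)) (z r) := fun r =>
    hm.comp (measurable_pi_apply r)
  have hbd : ∀ y, D.indicator (fun _ => (1 : ℝ)) y ∈ Set.Icc (0 : ℝ) 1 := fun y => by
    by_cases h : y ∈ D <;> simp [h]
  have hind : iIndepFun (fun r (z : ℕ → 𝓧) => D.indicator (fun _ => (1 : ℝ)) (z r)) c.drawsLaw :=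
    iIndepFun_infinitePi (X := fun _ => D.indicator (fun _ => (1 : ℝ))) fun _ => hm
  have heq : hits D u = ∑ r ∈ Finset.Ico (2 ^ u) (2 ^ u + cycleLen u),
      fun z : ℕ → 𝓧 => D.indicator (fun _ => (1 : ℝ)) (z r) := by
    ext z; simp [hits]
  rw [heq, IndepFun.variance_sum (fun r _ => MemLp.of_bound (hm' r).aestronglyMeasurable 1
    (ae_of_all _ fun z => by
      rw [Real.norm_eq_abs, abs_of_nonneg (hbd _).1]; exact (hbd _).2))
    fun r _ r' _ hne => hind.indepFun hne]
  calc _ ≤ ∑ r ∈ Finset.Ico (2 ^ u) (2 ^ u + cycleLen u), (1 : ℝ) := by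
        refine Finset.sum_le_sum fun r _ => ?_
        refine (variance_le_sq_of_bounded (a := 0) (b := 1) (ae_of_all _ fun z => hbd _)
          (hm' r).aemeasurable).trans (by norm_num)
    _ = cycleLen u := by simp
    _ ≤ 2 ^ u := by exact_mod_cast cycleLen_le u

/-- By Chebyshev's inequality and the Borel–Cantelli lemma, the number of hits is eventually
at most proportional to the measure of the target. -/
theorem ae_eventually_hits_le {D : Set 𝓧} (hD : MeasurableSet D) {δ : ℝ} (hδ : 0 < δ)
    (hDδ : ν.real D ≤ δ) : ∀ᵐ z ∂c.drawsLaw, ∀ᶠ u in atTop, hits D u z ≤ 5 * δ * 2 ^ u := by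
  have hmeas : ∀ u, Measurable (hits D u) := fun u => Finset.measurable_sum _ fun r _ =>
    (measurable_const.indicator hD).comp (measurable_pi_apply r)
  have hLp : ∀ u, MemLp (hits D u) 2 c.drawsLaw := fun u => by
    refine MemLp.of_bound (hmeas u).aestronglyMeasurable (cycleLen u) (ae_of_all _ fun z => ?_)
    refine (norm_sum_le _ _).trans ?_
    refine (Finset.sum_le_sum (g := fun _ => (1 : ℝ)) fun r _ => ?_).trans (by simp)
    by_cases h : z r ∈ D <;> simp [h]
  have hch : ∀ u, c.drawsLaw {z | δ * 2 ^ u ≤ |hits D u z - ∫ z, hits D u z ∂c.drawsLaw|} ≤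
      ENNReal.ofReal (1 / δ ^ 2 * (1 / 2) ^ u) := fun u => by
    refine (meas_ge_le_variance_div_sq (hLp u) (by positivity)).trans
      (ENNReal.ofReal_le_ofReal ?_)
    rw [div_le_iff₀ (by positivity)]
    refine (c.variance_hits_le hD u).trans (le_of_eq ?_)
    rw [mul_pow, one_div_pow]
    have : (2 : ℝ) ^ u ≠ 0 := by positivity
    field_simp
  have hsum : (∑' u, c.drawsLaw
      {z | δ * 2 ^ u ≤ |hits D u z - ∫ z, hits D u z ∂c.drawsLaw|}) ≠ ∞ := by
    refine ne_top_of_le_ne_top ?_ (ENNReal.tsum_le_tsum hch)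
    exact (Summable.mul_left _ (summable_geometric_of_lt_one (by norm_num)
      (by norm_num))).tsum_ofReal_ne_top
  filter_upwards [ae_eventually_notMem hsum] with z hz
  filter_upwards [hz] with u hu
  simp only [not_le] at hu
  have h1 := (abs_lt.1 hu).2
  have h2 := c.integral_hits_le hD u
  have h3 : (2 : ℝ) ^ (u + 2) * ν.real D ≤ 4 * δ * 2 ^ u := by
    rw [pow_add]
    have : (0 : ℝ) < 2 ^ u := by positivity
    nlinarith
  linarith

/-- Members with large index have a union of small measure, which by `ae_eventually_hits_le` is hit
by only a small proportion of the draws. -/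
theorem process_mem_C2 : c.process ∈ C2 𝓧 := by
  intro C hCm hC
  have key : ∀ m : ℕ, ∀ᵐ x ∂(c.process : Measure (ℕ → 𝓧)), ∀ᶠ T in atTop,
      (visitedCount C x T : ℝ) ≤ 1 / ((m : ℝ) + 1) * T := by
    intro m
    have hmeas : MeasurableSet {x : ℕ → 𝓧 | ∀ᶠ T in atTop,
        (visitedCount C x T : ℝ) ≤ 1 / ((m : ℝ) + 1) * T} := by
      simp only [eventually_atTop, Set.ofPred_exists, Set.ofPred_forall]
      exact .iUnion fun N => .iInter fun T => .iInter fun _ =>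
        measurableSet_le ((measurable_of_countable (Nat.cast : ℕ → ℝ)).comp
          (measurable_visitedCount hCm hC T)) measurable_const
    refine (ae_map_iff measurable_repeat.aemeasurable hmeas).2 ?_
    have hη : (0 : ℝ) < 1 / ((m : ℝ) + 1) := Nat.one_div_pos_of_nat
    set η : ℝ := 1 / ((m : ℝ) + 1) with hηdef
    -- The windows up to time `T` have at most `2 * T` draws, so hits contribute `10 * δ = η / 2`.
    set δ := η / 20 with hδ
    have hδ0 : 0 < δ := by positivity
    obtain ⟨K, hK⟩ : ∃ K : ℕ, ν.real (⋃ k, ⋃ _ : K ≤ k, C k) ≤ δ := by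
      have hanti : Antitone fun K : ℕ => ⋃ k, ⋃ _ : K ≤ k, C k := fun K K' h =>
        Set.iUnion_mono fun k => Set.iUnion_subset fun hk =>
          Set.subset_iUnion_of_subset (h.trans hk) subset_rfl
      have h := tendsto_measure_iInter_atTop (μ := ν) (fun K : ℕ => (MeasurableSet.iUnion fun k =>
        MeasurableSet.iUnion fun _ : K ≤ k => hCm k).nullMeasurableSet) hanti
        ⟨0, measure_ne_top _ _⟩
      have hempty : ⋂ K : ℕ, ⋃ k, ⋃ _ : K ≤ k, C k = ∅ := by
        refine Set.eq_empty_of_forall_notMem fun y hy => ?_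
        rw [Set.mem_iInter] at hy
        obtain ⟨k, -, hk⟩ := Set.mem_iUnion₂.1 (hy 0)
        obtain ⟨k', hkk, hk'⟩ := Set.mem_iUnion₂.1 (hy (k + 1))
        exact Set.disjoint_left.1 (hC (show k ≠ k' by omega)) hk hk'
      rw [hempty, measure_empty] at h
      obtain ⟨K, hK⟩ := (h.eventually (gt_mem_nhds (ENNReal.ofReal_pos.2 hδ0))).exists
      refine ⟨K, ?_⟩
      rw [measureReal_def]
      exact ENNReal.toReal_le_of_le_ofReal hδ0.le hK.le
    have hDm : MeasurableSet (⋃ k, ⋃ _ : K ≤ k, C k) := .iUnion fun k => .iUnion fun _ => hCm k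
    filter_upwards [c.ae_eventually_hits_le hDm hδ0 hK] with z hz
    obtain ⟨U, hU⟩ := eventually_atTop.1 hz
    set S : ℝ := ∑ u ∈ Finset.range U, hits (⋃ k, ⋃ _ : K ≤ k, C k) u z with hS
    obtain ⟨T₀, hT₀⟩ := exists_nat_ge ((K + S) / (η / 2))
    filter_upwards [eventually_ge_atTop T₀, eventually_ge_atTop 1] with T hT hT1
    have hnn : ∀ u, 0 ≤ hits (⋃ k, ⋃ _ : K ≤ k, C k) u z := fun u => Finset.sum_nonneg fun r _ =>
      Set.indicator_nonneg (fun _ _ => zero_le_one) _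
    have h1 := visitedCount_repeat_le hC K T z
    have h2 : ∑ u ∈ Finset.range (Nat.log 2 T + 1), hits (⋃ k, ⋃ _ : K ≤ k, C k) u z ≤
        S + ∑ u ∈ Finset.range (Nat.log 2 T + 1), 5 * δ * 2 ^ u := by
      have : ∀ u, hits (⋃ k, ⋃ _ : K ≤ k, C k) u z ≤
          (if u < U then hits (⋃ k, ⋃ _ : K ≤ k, C k) u z else 0) + 5 * δ * 2 ^ u := fun u => by
        split_ifs with h
        · have : 0 ≤ 5 * δ * 2 ^ u := by positivity
          linarith
        · simpa using hU u (not_lt.1 h)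
      refine (Finset.sum_le_sum fun u _ => this u).trans ?_
      rw [Finset.sum_add_distrib]
      refine add_le_add_left ?_ _
      rw [← Finset.sum_filter, hS]
      refine Finset.sum_le_sum_of_subset_of_nonneg (fun u hu => ?_) fun u _ _ => hnn u
      exact Finset.mem_range.2 (Finset.mem_filter.1 hu).2
    have h3 : ∑ u ∈ Finset.range (Nat.log 2 T + 1), 5 * δ * (2 : ℝ) ^ u ≤ 10 * δ * T := by
      rw [← Finset.mul_sum, geom_sum_eq (by norm_num)]
      have h4 : (2 : ℝ) ^ Nat.log 2 T ≤ T := by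
        exact_mod_cast Nat.pow_log_le_self 2 (by omega)
      rw [pow_succ]
      nlinarith
    have h5 : K + S ≤ η / 2 * T := by
      have : (T₀ : ℝ) ≤ T := by exact_mod_cast hT
      have h6 := hT₀.trans this
      rw [div_le_iff₀ (by positivity)] at h6
      linarith
    have h7 : 10 * δ * T = η / 2 * T := by rw [hδ]; ring
    linarith
  filter_upwards [ae_all_iff.2 key] with x hx
  refine Asymptotics.isLittleO_iff.2 fun ε hε => ?_
  obtain ⟨m, hm⟩ := exists_nat_one_div_lt hε
  filter_upwards [hx m] with T hT
  simp only [Real.norm_natCast]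
  exact hT.trans (mul_le_mul_of_nonneg_right hm.le (Nat.cast_nonneg _))

end CellSystem

/-! ### Rounds of a window -/

/-- The cycle, within its window, to which time `τ` belongs. -/
def cycleIdx (τ : ℕ) : ℕ := (τ - 2 ^ Nat.log 2 τ) / cycleLen (Nat.log 2 τ)

/-- The round (counted from `0`) of window `u` at cycle `v` and position `w`. -/
def round (u v : ℕ) (w : Fin (cycleLen u)) : ℕ := 2 ^ u - 1 + (v * cycleLen u + w)

theorem cycle_add_pos_lt {u v : ℕ} (hv : v < 2 ^ winType u) (w : Fin (cycleLen u)) :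
    v * cycleLen u + w < 2 ^ u := by
  rw [← two_pow_winType_mul_cycleLen]
  have := Nat.mul_le_mul_right (cycleLen u) (Nat.succ_le_of_lt hv)
  rw [Nat.succ_mul] at this
  omega

theorem round_add_one (u v : ℕ) (w : Fin (cycleLen u)) :
    round u v w + 1 = 2 ^ u + (v * cycleLen u + w) := by
  have : 0 < 2 ^ u := by positivity
  unfold round; omega

theorem log_round {u v : ℕ} (hv : v < 2 ^ winType u) (w : Fin (cycleLen u)) :
    Nat.log 2 (round u v w + 1) = u := by
  rw [round_add_one, log_two_pow_add (cycle_add_pos_lt hv w)]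

theorem cyclePos_round {u v : ℕ} (hv : v < 2 ^ winType u) (w : Fin (cycleLen u)) :
    cyclePos (round u v w + 1) = w := by
  rw [round_add_one, cyclePos_two_pow_add (cycle_add_pos_lt hv w), mul_comm, Nat.mul_add_mod,
    Nat.mod_eq_of_lt w.2]

theorem cycleIdx_round {u v : ℕ} (hv : v < 2 ^ winType u) (w : Fin (cycleLen u)) :
    cycleIdx (round u v w + 1) = v := by
  rw [cycleIdx, log_round hv, round_add_one, Nat.add_sub_cancel_left, mul_comm,
    Nat.mul_add_div (cycleLen_pos u), Nat.div_eq_of_lt w.2, add_zero]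

theorem exists_round_eq {t u : ℕ} (h : Nat.log 2 (t + 1) = u) :
    ∃ v < 2 ^ winType u, ∃ w : Fin (cycleLen u), t = round u v w := by
  obtain ⟨h1, h2⟩ := (Nat.log_eq_iff (Or.inr ⟨one_lt_two, by omega⟩)).1 h
  obtain ⟨j, hj⟩ := Nat.exists_eq_add_of_le h1
  have hju : j < 2 ^ u := by rw [pow_succ] at h2; omega
  refine ⟨j / cycleLen u, ?_, ⟨j % cycleLen u, Nat.mod_lt _ (cycleLen_pos u)⟩, ?_⟩
  · rw [Nat.div_lt_iff_lt_mul (cycleLen_pos u), two_pow_winType_mul_cycleLen]; exact hju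
  · have := Nat.div_add_mod j (cycleLen u)
    apply Nat.add_right_cancel (m := 1)
    rw [round_add_one, hj, mul_comm]
    simp only
    omega

theorem round_lt_round {u v v' : ℕ} {w w' : Fin (cycleLen u)} (h : round u v' w' < round u v w) :
    v' ≤ v ∧ (w' = w → v' < v) := by
  unfold round at h
  have h1 : v' ≤ v := by
    by_contra hlt
    have := Nat.mul_le_mul_right (cycleLen u) (Nat.succ_le_of_lt (not_le.1 hlt))
    rw [Nat.succ_mul] at this
    omega
  refine ⟨h1, fun hw => lt_of_le_of_ne h1 fun hv => ?_⟩
  subst hw; subst hv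
  omega

/-- The rounds of window `u`. -/
def window (u : ℕ) : Finset ℕ := Finset.Ico (2 ^ u - 1) (2 ^ (u + 1) - 1)

theorem mem_window {t u : ℕ} : t ∈ window u ↔ Nat.log 2 (t + 1) = u := by
  rw [window, Finset.mem_Ico, Nat.log_eq_iff (Or.inr ⟨one_lt_two, by omega⟩)]
  have : 0 < 2 ^ (u + 1) := by positivity
  omega

theorem card_window (u : ℕ) : (window u).card = 2 ^ u := by
  rw [window, Nat.card_Ico, pow_succ]; omega

theorem sum_range_mul {M : Type*} [AddCommMonoid M] (F : ℕ → M) (m N : ℕ) :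
    ∑ j ∈ Finset.range (m * N), F j = ∑ v ∈ Finset.range m, ∑ w : Fin N, F (v * N + w) := by
  induction m with
  | zero => simp
  | succ m ih =>
    rw [Nat.succ_mul, Finset.sum_range_add, Finset.sum_range_succ, ih,
      Finset.sum_range fun x => F (m * N + x)]

theorem sum_window {M : Type*} [AddCommMonoid M] (F : ℕ → M) (u : ℕ) :
    ∑ t ∈ window u, F t =
      ∑ v ∈ Finset.range (2 ^ winType u), ∑ w : Fin (cycleLen u), F (round u v w) := by
  rw [window, Finset.sum_Ico_eq_sum_range, show 2 ^ (u + 1) - 1 - (2 ^ u - 1) =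
    2 ^ winType u * cycleLen u by rw [two_pow_winType_mul_cycleLen, pow_succ]; omega,
    sum_range_mul]
  rfl

theorem sum_range_eq_sum_window {M : Type*} [AddCommMonoid M] (F : ℕ → M) (u : ℕ) :
    ∑ t ∈ Finset.range (2 ^ u - 1), F t = ∑ w ∈ Finset.range u, ∑ t ∈ window w, F t := by
  induction u with
  | zero => simp
  | succ u ih =>
    rw [Finset.sum_range_succ, ← ih, window, Finset.sum_range_add_sum_Ico]
    exact Nat.sub_le_sub_right (Nat.pow_le_pow_right two_pos (Nat.le_succ u)) 1

/-! ### Scheduled rewards -/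

/-- A schedule prescribes for every window either that all rewards vanish (`none`), or a number of
cycles and a bit for each position. -/
abbrev Schedule : Type := ∀ u : ℕ, Option (ℕ × (Fin (cycleLen u) → Bool))

section Scheduled

variable {𝓧 : Type u} {A : Type v} [MeasurableSpace 𝓧] [MeasurableSpace A]
  [MeasurableSingletonClass A] {ν : Measure 𝓧} (c : CellSystem ν)

/-- The union of the cells of window `u` whose bit is set. -/
def CellSystem.target (u : ℕ) (g : Fin (cycleLen u) → Bool) : Set 𝓧 :=
  {x | ∃ w, g w = true ∧ x ∈ c.cell u w}

theorem CellSystem.measurableSet_target (u : ℕ) (g : Fin (cycleLen u) → Bool) :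
    MeasurableSet (c.target u g) := by
  have : c.target u g = ⋃ w, ⋃ _ : g w = true, c.cell u w := by
    ext x; simp [CellSystem.target]
  rw [this]
  exact .iUnion fun w => .iUnion fun _ => c.measurableSet_cell u w

theorem CellSystem.target_subset_block (u : ℕ) (g : Fin (cycleLen u) → Bool) :
    c.target u g ⊆ c.block (winType u) := by
  rintro x ⟨w, -, hx⟩
  exact c.cell_subset u w w.2 hx

/-- The paths which at each time are in the cell assigned to this time. -/
def CellSystem.IsRegular (x : ℕ → 𝓧) : Prop :=
  ∀ t, x t ∈ c.cell (Nat.log 2 (t + 1)) (cyclePos (t + 1))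

theorem CellSystem.IsRegular.mem_target_iff {c : CellSystem ν} {x : ℕ → 𝓧} (hx : c.IsRegular x)
    {u v : ℕ} (hv : v < 2 ^ winType u) (w : Fin (cycleLen u)) (g : Fin (cycleLen u) → Bool) :
    x (round u v w) ∈ c.target u g ↔ g w = true := by
  have hmem := hx (round u v w)
  rw [log_round hv, cyclePos_round hv] at hmem
  refine ⟨fun ⟨w', hw', hx'⟩ => ?_, fun h => ⟨w, h, hmem⟩⟩
  have : w' = w := by
    by_contra hne
    rcases lt_or_gt_of_ne hne with h | h
    · exact Set.disjoint_left.1 (c.disjoint_cell u _ _ h w.2) hx' hmem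
    · exact Set.disjoint_left.1 (c.disjoint_cell u _ _ h w'.2) hmem hx'
  exact this ▸ hw'

open Classical in
/-- The reward of a scheduled window: the safe action `a₁` earns `3 / 4`. All other actions are
risky: they earn `1` during the prescribed number of cycles on the cells whose bit is set, and `0`
otherwise. The value `3 / 4` lies between the payoff `1` of a risky action that is known to pay and
the mean `1 / 2` of one whose bit is unknown. -/
noncomputable def schedFun (a₁ : A) (S : Schedule) (t : ℕ) (a : A) (x : 𝓧) : I :=
  match S (Nat.log 2 (t + 1)) with
  | none => 0
  | some p => if a = a₁ then ⟨3 / 4, by norm_num, by norm_num⟩ else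
      if cycleIdx (t + 1) < p.1 ∧ x ∈ c.target _ p.2 then 1 else 0

theorem measurable_schedFun (a₁ : A) (S : Schedule) (t : ℕ) :
    Measurable fun p : A × 𝓧 => schedFun c a₁ S t p.1 p.2 := by
  unfold schedFun
  cases S (Nat.log 2 (t + 1)) with
  | none => exact measurable_const
  | some p =>
    refine Measurable.ite (measurable_fst (measurableSet_singleton a₁)) measurable_const
      (Measurable.ite ?_ measurable_const measurable_const)
    exact (MeasurableSet.const _).inter (measurable_snd (c.measurableSet_target _ _))

/-- The reward mechanism of a schedule. -/
noncomputable def schedReward (a₁ : A) (S : Schedule) : ObliviousReward 𝓧 A :=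
  .ofFun (schedFun c a₁ S) (measurable_schedFun c a₁ S)

variable (a₁ : A) {S S' : Schedule} (t : ℕ) (y : I) (a : A) (x : 𝓧)

theorem schedReward_none {u : ℕ} (hu : Nat.log 2 (t + 1) = u) (h : S u = none) :
    (schedReward c a₁ S).reward t y a x = 0 := by
  subst hu
  change schedFun c a₁ S t a x = 0
  unfold schedFun
  rw [h]

open Classical in
theorem schedReward_some {u : ℕ} (hu : Nat.log 2 (t + 1) = u)
    {p : ℕ × (Fin (cycleLen u) → Bool)} (h : S u = some p) :
    ((schedReward c a₁ S).reward t y a x : ℝ) = if a = a₁ then 3 / 4 else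
      if cycleIdx (t + 1) < p.1 ∧ x ∈ c.target u p.2 then 1 else 0 := by
  subst hu
  change ((schedFun c a₁ S t a x : I) : ℝ) = _
  unfold schedFun
  rw [h]
  simp only
  split_ifs <;> rfl

theorem schedReward_congr (h : S (Nat.log 2 (t + 1)) = S' (Nat.log 2 (t + 1))) :
    (schedReward c a₁ S).reward t y a x = (schedReward c a₁ S').reward t y a x := by
  change schedFun c a₁ S t a x = schedFun c a₁ S' t a x
  unfold schedFun
  rw [h]

end Scheduled

/-! ### Regret in a window -/

section WindowRegret

variable {𝓧 : Type u} {A : Type v} [MeasurableSpace 𝓧] [MeasurableSpace A]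

/-- The regret accumulated in window `u`. -/
noncomputable def winRegret (f : LearningRule.{u, v, w} 𝓧 A) (R : ObliviousReward 𝓧 A)
    (π : 𝓧 → A) (u : ℕ) (z : (ℕ → 𝓧) × f.Seed × (ℕ → I)) : ℝ :=
  ∑ t ∈ window u, ((R.reward t (z.2.2 t) (π (z.1 t)) (z.1 t) : ℝ) -
    (R.reward t (z.2.2 t) (action f R z.2.1 z.1 z.2.2 t) (z.1 t) : ℝ))

variable (f : LearningRule.{u, v, w} 𝓧 A) (R : ObliviousReward 𝓧 A) (π : 𝓧 → A)

theorem avgRegret_eq_sum_winRegret (u : ℕ) (z : (ℕ → 𝓧) × f.Seed × (ℕ → I)) :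
    avgRegret f R π z.2.1 z.1 z.2.2 (2 ^ u - 1) =
      1 / ((2 ^ u - 1 : ℕ) : ℝ) * ∑ w ∈ Finset.range u, winRegret f R π w z := by
  unfold avgRegret winRegret
  rw [sum_range_eq_sum_window]

theorem abs_winRegret_le (u : ℕ) (z : (ℕ → 𝓧) × f.Seed × (ℕ → I)) :
    |winRegret f R π u z| ≤ 2 ^ u := by
  unfold winRegret
  refine (Finset.abs_sum_le_sum_abs _ _).trans ?_
  refine (Finset.sum_le_sum (g := fun _ => (1 : ℝ)) fun t _ => ?_).trans (by simp [card_window])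
  rw [abs_le]
  have h1 := (R.reward t (z.2.2 t) (π (z.1 t)) (z.1 t)).2
  have h2 := (R.reward t (z.2.2 t) (action f R z.2.1 z.1 z.2.2 t) (z.1 t)).2
  constructor <;> linarith [h1.1, h1.2, h2.1, h2.2]

variable {π}

theorem measurable_winRegret (hπ : Measurable π) (u : ℕ) : Measurable (winRegret f R π u) := by
  unfold winRegret
  refine Finset.measurable_sum _ fun t _ => ?_
  have hx : Measurable fun z : (ℕ → 𝓧) × f.Seed × (ℕ → I) => z.1 t :=
    (measurable_pi_apply t).comp measurable_fst
  have hn : Measurable fun z : (ℕ → 𝓧) × f.Seed × (ℕ → I) => z.2.2 t :=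
    (measurable_pi_apply t).comp (by fun_prop)
  exact (measurable_subtype_coe.comp ((R.measurable_reward t).comp
    (hn.prodMk ((hπ.comp hx).prodMk hx)))).sub (measurable_subtype_coe.comp
    ((R.measurable_reward t).comp (hn.prodMk ((measurable_action_of_fixed f R t).prodMk hx))))

theorem integrable_winRegret (μ : ContextProcess 𝓧) (hπ : Measurable π) (u : ℕ) :
    Integrable (winRegret f R π u) (runLaw μ f) :=
  Integrable.of_bound (measurable_winRegret f R hπ u).aestronglyMeasurable (2 ^ u)
    (ae_of_all _ fun z => abs_winRegret_le f R π u z)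

theorem neg_le_integral_winRegret (μ : ContextProcess 𝓧) (hπ : Measurable π) (u : ℕ) :
    -2 ^ u ≤ ∫ z, winRegret f R π u z ∂runLaw μ f := by
  calc (-2 ^ u : ℝ) = ∫ _, (-2 ^ u : ℝ) ∂runLaw μ f := by simp
    _ ≤ _ := integral_mono (integrable_const _) (integrable_winRegret f R μ hπ u)
      fun z => (abs_le.1 (abs_winRegret_le f R π u z)).1

theorem integral_avgRegret (μ : ContextProcess 𝓧) (hπ : Measurable π) (u : ℕ) :
    ∫ z, avgRegret f R π z.2.1 z.1 z.2.2 (2 ^ u - 1) ∂runLaw μ f =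
      1 / ((2 ^ u - 1 : ℕ) : ℝ) *
        ∑ w ∈ Finset.range u, ∫ z, winRegret f R π w z ∂runLaw μ f := by
  simp only [avgRegret_eq_sum_winRegret]
  rw [integral_const_mul, integral_finsetSum _ fun w _ => integrable_winRegret f R μ hπ w]

variable [MeasurableSingletonClass A] {ν : Measure 𝓧} (c : CellSystem ν) (a₁ : A)
  {S S' : Schedule}

/-- The actions up to the end of window `U - 1`, and in the first round of window `U`, depend only
on the schedule of the windows below `U`. -/
theorem action_schedReward_congr {U t : ℕ} (h : ∀ w < U, S w = S' w) (ht : t < 2 ^ U)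
    (s : f.Seed) (x : ℕ → 𝓧) (n : ℕ → I) :
    action f (schedReward c a₁ S) s x n t = action f (schedReward c a₁ S') s x n t :=
  action_congr f s x n t fun j hj => schedReward_congr c a₁ j _ _ _
    (h _ (Nat.log_lt_of_lt_pow (by omega) (by omega)))

theorem winRegret_schedReward_congr {U u : ℕ} (h : ∀ w < U, S w = S' w) (hu : u < U) (π : 𝓧 → A)
    (z : (ℕ → 𝓧) × f.Seed × (ℕ → I)) :
    winRegret f (schedReward c a₁ S) π u z = winRegret f (schedReward c a₁ S') π u z := by
  unfold winRegret
  refine Finset.sum_congr rfl fun t ht => ?_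
  have hlog := mem_window.1 ht
  have hS : S (Nat.log 2 (t + 1)) = S' (Nat.log 2 (t + 1)) := h _ (hlog ▸ hu)
  have ht' : t < 2 ^ U := by
    have := Nat.lt_pow_of_log_lt one_lt_two (hlog ▸ hu : Nat.log 2 (t + 1) < U)
    omega
  rw [action_schedReward_congr f c a₁ h ht', schedReward_congr c a₁ t _ _ _ hS,
    schedReward_congr c a₁ t _ _ _ hS]

theorem winRegret_schedReward_none {u : ℕ} (h : S u = none) (π : 𝓧 → A)
    (z : (ℕ → 𝓧) × f.Seed × (ℕ → I)) : winRegret f (schedReward c a₁ S) π u z = 0 := by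
  unfold winRegret
  refine Finset.sum_eq_zero fun t ht => ?_
  rw [schedReward_none c a₁ t _ _ _ (mem_window.1 ht) h,
    schedReward_none c a₁ t _ _ _ (mem_window.1 ht) h, sub_self]

end WindowRegret

/-! ### The game in a single window -/

section Game

variable {𝓧 : Type u} {A : Type v} [MeasurableSpace 𝓧] [MeasurableSpace A]
  [MeasurableSingletonClass A] {ν : Measure 𝓧} (c : CellSystem ν) (a₁ : A)
  (f : LearningRule.{u, v, w} 𝓧 A) (S : Schedule) {u : ℕ}

/-- The schedule `S` with new values in window `u`. -/
def Schedule.set (S : Schedule) (u q : ℕ) (g : Fin (cycleLen u) → Bool) : Schedule :=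
  Function.update S u (some (q, g))

theorem Schedule.set_self (q : ℕ) (g : Fin (cycleLen u) → Bool) :
    S.set u q g u = some (q, g) := Function.update_self ..

theorem Schedule.set_of_ne {q : ℕ} {g : Fin (cycleLen u) → Bool} {u' : ℕ} (h : u' ≠ u) :
    S.set u q g u' = S u' := Function.update_of_ne h ..

/-- The rule plays a risky action in round `t`. -/
def IsRisky (z : (ℕ → 𝓧) × f.Seed × (ℕ → I)) (t : ℕ) : Prop :=
  action f (schedReward c a₁ S) z.2.1 z.1 z.2.2 t ≠ a₁

/-- If risky actions pay during the whole window, the first risky play at position `w` takes place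
in cycle `v`. -/
def IsFirstRisky (g : Fin (cycleLen u) → Bool) (z : (ℕ → 𝓧) × f.Seed × (ℕ → I)) (v : ℕ)
    (w : Fin (cycleLen u)) : Prop :=
  IsRisky c a₁ f (S.set u (2 ^ winType u) g) z (round u v w) ∧
    ∀ v' < v, ¬ IsRisky c a₁ f (S.set u (2 ^ winType u) g) z (round u v' w)

variable {S} {z : (ℕ → 𝓧) × f.Seed × (ℕ → I)}

/-- The number of paying cycles is not noticed before it is over. -/
theorem isRisky_congr_cap {q q' v : ℕ} (hq : v < q) (hq' : v < q')
    (w : Fin (cycleLen u)) (g : Fin (cycleLen u) → Bool) :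
    IsRisky c a₁ f (S.set u q g) z (round u v w) ↔
      IsRisky c a₁ f (S.set u q' g) z (round u v w) := by
  classical
  unfold IsRisky
  rw [action_congr f z.2.1 z.1 z.2.2 _ fun j hj => ?_]
  by_cases hlog : Nat.log 2 (j + 1) = u
  · obtain ⟨v', hv', w', rfl⟩ := exists_round_eq hlog
    have hle := (round_lt_round hj).1
    apply Subtype.ext
    rw [schedReward_some c a₁ _ _ _ _ hlog (S.set_self q g),
      schedReward_some c a₁ _ _ _ _ hlog (S.set_self q' g), cycleIdx_round hv']
    simp only [hle.trans_lt hq, hle.trans_lt hq']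
  · exact schedReward_congr c a₁ _ _ _ _ (by rw [S.set_of_ne hlog, S.set_of_ne hlog])

/-- Before the first risky play at a position, the bit of this position has no influence. -/
theorem isRisky_congr_bit (hz : c.IsRegular z.1) {q v : ℕ} {w : Fin (cycleLen u)}
    {g g' : Fin (cycleLen u) → Bool} (hg : ∀ w', w' ≠ w → g w' = g' w')
    (h : ∀ v' < v, ¬ IsRisky c a₁ f (S.set u q g) z (round u v' w)) :
    IsRisky c a₁ f (S.set u q g) z (round u v w) ↔
      IsRisky c a₁ f (S.set u q g') z (round u v w) := by
  classical
  unfold IsRisky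
  rw [action_congr f z.2.1 z.1 z.2.2 _ fun j hj => ?_]
  by_cases hlog : Nat.log 2 (j + 1) = u
  · obtain ⟨v', hv', w', rfl⟩ := exists_round_eq hlog
    apply Subtype.ext
    rw [schedReward_some c a₁ _ _ _ _ hlog (S.set_self q g),
      schedReward_some c a₁ _ _ _ _ hlog (S.set_self q g'), cycleIdx_round hv',
      hz.mem_target_iff hv', hz.mem_target_iff hv']
    by_cases hw : w' = w
    · have := h v' ((round_lt_round hj).2 hw)
      rw [hw]
      unfold IsRisky at this
      rw [not_not] at this
      rw [if_pos this, if_pos this]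
    · simp only [hg w' hw]
      congr
  · exact schedReward_congr c a₁ _ _ _ _ (by rw [S.set_of_ne hlog, S.set_of_ne hlog])

/-- Flip the bit of one position. -/
def flipBit (w : Fin (cycleLen u)) : (Fin (cycleLen u) → Bool) ≃ (Fin (cycleLen u) → Bool) :=
  Function.Involutive.toPerm (fun g => Function.update g w (!g w)) fun g => by simp

theorem flipBit_self (w : Fin (cycleLen u)) (g : Fin (cycleLen u) → Bool) :
    flipBit w g w = !g w := Function.update_self ..

theorem flipBit_of_ne {w w' : Fin (cycleLen u)} (h : w' ≠ w) (g : Fin (cycleLen u) → Bool) :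
    flipBit w g w' = g w' := Function.update_of_ne h ..

theorem flipBit_flipBit (w : Fin (cycleLen u)) (g : Fin (cycleLen u) → Bool) :
    flipBit w (flipBit w g) = g :=
  Function.Involutive.toPerm_involutive
    (show Function.Involutive fun g : Fin (cycleLen u) → Bool => Function.update g w (!g w) from
      fun g => by simp) g

theorem isFirstRisky_flipBit (hz : c.IsRegular z.1) (v : ℕ) (w : Fin (cycleLen u))
    (g : Fin (cycleLen u) → Bool) :
    IsFirstRisky c a₁ f S (flipBit w g) z v w ↔ IsFirstRisky c a₁ f S g z v w := by
  suffices h : ∀ g, IsFirstRisky c a₁ f S g z v w → IsFirstRisky c a₁ f S (flipBit w g) z v w by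
    refine ⟨fun h' => ?_, h g⟩
    have := h _ h'
    rwa [flipBit_flipBit] at this
  intro g ⟨h1, h2⟩
  have hg : ∀ w', w' ≠ w → g w' = flipBit w g w' := fun w' hw => (flipBit_of_ne hw g).symm
  refine ⟨(isRisky_congr_bit c a₁ f hz hg h2).1 h1, fun v' hv' => ?_⟩
  exact (not_congr (isRisky_congr_bit c a₁ f hz hg fun v'' hv'' => h2 v'' (hv''.trans hv'))).1
    (h2 v' hv')

open Classical in
/-- The bit of a position is fair, also given that the first risky play there is in cycle `v`. -/
theorem sum_isFirstRisky_bit (hz : c.IsRegular z.1) (v : ℕ) (w : Fin (cycleLen u)) :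
    ∑ g : Fin (cycleLen u) → Bool,
      (if IsFirstRisky c a₁ f S g z v w then (if g w = true then (1 : ℝ) else 0) else 0) =
    1 / 2 * ∑ g : Fin (cycleLen u) → Bool,
      if IsFirstRisky c a₁ f S g z v w then (1 : ℝ) else 0 := by
  have h := Equiv.sum_comp (flipBit w) fun g : Fin (cycleLen u) → Bool =>
    if IsFirstRisky c a₁ f S g z v w then (if g w = true then (1 : ℝ) else 0) else 0
  have h2 : ∑ g : Fin (cycleLen u) → Bool,
      (if IsFirstRisky c a₁ f S g z v w then (if g w = true then (1 : ℝ) else 0) else 0) +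
      ∑ g : Fin (cycleLen u) → Bool,
        (if IsFirstRisky c a₁ f S (flipBit w g) z v w then
          (if flipBit w g w = true then (1 : ℝ) else 0) else 0) =
      ∑ g : Fin (cycleLen u) → Bool, if IsFirstRisky c a₁ f S g z v w then (1 : ℝ) else 0 := by
    rw [← Finset.sum_add_distrib]
    refine Finset.sum_congr rfl fun g _ => ?_
    rw [flipBit_self]
    simp only [isFirstRisky_flipBit c a₁ f hz v w g]
    by_cases h1 : IsFirstRisky c a₁ f S g z v w <;> cases g w <;> simp [h1]
  linarith

open Classical in
theorem sum_bit (w : Fin (cycleLen u)) :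
    ∑ g : Fin (cycleLen u) → Bool, (if g w = true then (1 : ℝ) else 0) =
      1 / 2 * Fintype.card (Fin (cycleLen u) → Bool) := by
  have h := Equiv.sum_comp (flipBit w) fun g : Fin (cycleLen u) → Bool =>
    if g w = true then (1 : ℝ) else 0
  have h2 : ∑ g : Fin (cycleLen u) → Bool, (if g w = true then (1 : ℝ) else 0) +
      ∑ g : Fin (cycleLen u) → Bool, (if flipBit w g w = true then (1 : ℝ) else 0) =
      ∑ g : Fin (cycleLen u) → Bool, (1 : ℝ) := by
    rw [← Finset.sum_add_distrib]
    refine Finset.sum_congr rfl fun g _ => ?_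
    rw [flipBit_self]
    cases g w <;> simp
  rw [Finset.sum_const, nsmul_eq_mul, mul_one, Finset.card_univ] at h2
  linarith

open Classical in
/-- The number of positions with first risky play in cycle `v`. -/
noncomputable def firstRiskyCount (S : Schedule) (v : ℕ) (g : Fin (cycleLen u) → Bool)
    (z : (ℕ → 𝓧) × f.Seed × (ℕ → I)) : ℝ :=
  ∑ w : Fin (cycleLen u), if IsFirstRisky c a₁ f S g z v w then 1 else 0

open Classical in
/-- The regret with respect to the safe action stems from risky plays. -/
theorem winRegret_const_eq (hz : c.IsRegular z.1) (q : ℕ) (g : Fin (cycleLen u) → Bool) :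
    winRegret f (schedReward c a₁ (S.set u q g)) (fun _ => a₁) u z =
      ∑ w : Fin (cycleLen u), ∑ v ∈ Finset.range (2 ^ winType u),
        if IsRisky c a₁ f (S.set u q g) z (round u v w) then
          (3 / 4 - if v < q ∧ g w = true then (1 : ℝ) else 0) else 0 := by
  rw [winRegret, sum_window, Finset.sum_comm]
  refine Finset.sum_congr rfl fun w _ => Finset.sum_congr rfl fun v hv => ?_
  have hv := Finset.mem_range.1 hv
  rw [schedReward_some c a₁ _ _ _ _ (log_round hv w) (S.set_self q g),
    schedReward_some c a₁ _ _ _ _ (log_round hv w) (S.set_self q g), cycleIdx_round hv,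
    hz.mem_target_iff hv, if_pos rfl]
  unfold IsRisky
  by_cases h : action f (schedReward c a₁ (S.set u q g)) z.2.1 z.1 z.2.2 (round u v w) = a₁
  · rw [if_pos h, if_neg (not_not.2 h), sub_self]
  · rw [if_neg h, if_pos h]
    congr

open Classical in
/-- If risky actions pay only up to cycle `v`, then on average over the bits each first risky play
in cycle `v` costs at least `3 / 4 - 1 / 2 = 1 / 4`, and later risky plays at the same position
do not make up for it. Positions with an earlier first risky play can gain at most `1` per cycle. -/
theorem sum_winRegret_const_ge (hz : c.IsRegular z.1) {v : ℕ} (hv : v < 2 ^ winType u) :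
    ∑ g : Fin (cycleLen u) → Bool, (1 / 4 * firstRiskyCount c a₁ f S v g z -
        2 ^ winType u * ∑ v' ∈ Finset.range v, firstRiskyCount c a₁ f S v' g z) ≤
      ∑ g : Fin (cycleLen u) → Bool,
        winRegret f (schedReward c a₁ (S.set u (v + 1) g)) (fun _ => a₁) u z := by
  set m := 2 ^ winType u with hm
  set φ : (Fin (cycleLen u) → Bool) → ℕ → Fin (cycleLen u) → ℝ := fun g v w =>
    if IsFirstRisky c a₁ f S g z v w then 1 else 0 with hφ
  have hpos : ∀ (g : Fin (cycleLen u) → Bool) (w : Fin (cycleLen u)),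
      (if IsFirstRisky c a₁ f S g z v w then (3 / 4 - if g w = true then (1 : ℝ) else 0) else 0) -
        m * ∑ v' ∈ Finset.range v, φ g v' w ≤
      ∑ v' ∈ Finset.range m,
        if IsRisky c a₁ f (S.set u (v + 1) g) z (round u v' w) then
          (3 / 4 - if v' < v + 1 ∧ g w = true then (1 : ℝ) else 0) else 0 := by
    intro g w
    have hsum0 : 0 ≤ ∑ v' ∈ Finset.range v, φ g v' w := Finset.sum_nonneg fun v' _ => by
      simp only [hφ]; split_ifs <;> norm_num
    by_cases hex : ∃ v' < v, IsRisky c a₁ f (S.set u m g) z (round u v' w)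
    · have hnot : ¬ IsFirstRisky c a₁ f S g z v w := by
        obtain ⟨v', hv', h⟩ := hex
        exact fun hf => hf.2 v' hv' h
      have hfirst : 1 ≤ ∑ v' ∈ Finset.range v, φ g v' w := by
        have h1 := Nat.find_spec hex
        have h2 : IsFirstRisky c a₁ f S g z (Nat.find hex) w := by
          refine ⟨h1.2, fun v' hv' h => Nat.find_min hex hv' ⟨hv'.trans h1.1, h⟩⟩
        calc (1 : ℝ) = φ g (Nat.find hex) w := by simp only [hφ, if_pos h2]
          _ ≤ _ := Finset.single_le_sum (f := fun v' => φ g v' w) (fun v' _ => by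
            simp only [hφ]; split_ifs <;> norm_num) (Finset.mem_range.2 h1.1)
      rw [if_neg hnot]
      have hm0 : (0 : ℝ) ≤ m := Nat.cast_nonneg _
      have hlow : -(m : ℝ) ≤ ∑ v' ∈ Finset.range m,
          if IsRisky c a₁ f (S.set u (v + 1) g) z (round u v' w) then
            (3 / 4 - if v' < v + 1 ∧ g w = true then (1 : ℝ) else 0) else 0 := by
        calc -(m : ℝ) = ∑ v' ∈ Finset.range m, (-1 : ℝ) := by simp
          _ ≤ _ := Finset.sum_le_sum fun v' _ => by split_ifs <;> norm_num
      nlinarith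
    · push Not at hex
      have hiff : ∀ v' ≤ v, (IsRisky c a₁ f (S.set u (v + 1) g) z (round u v' w) ↔
          IsRisky c a₁ f (S.set u m g) z (round u v' w)) := fun v' hv' =>
        isRisky_congr_cap c a₁ f (by omega) (by omega) w g
      have hfv : IsFirstRisky c a₁ f S g z v w ↔
          IsRisky c a₁ f (S.set u (v + 1) g) z (round u v w) := by
        rw [hiff v le_rfl]
        exact ⟨fun h => h.1, fun h => ⟨h, hex⟩⟩
      have hterm : ∀ v' ∈ Finset.range m, v' ≠ v → (0 : ℝ) ≤
          if IsRisky c a₁ f (S.set u (v + 1) g) z (round u v' w) then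
            (3 / 4 - if v' < v + 1 ∧ g w = true then (1 : ℝ) else 0) else 0 := by
        intro v' _ hne
        rcases Nat.lt_or_ge v' v with h | h
        · rw [if_neg]
          rw [hiff v' h.le]
          exact hex v' h
        · rw [if_neg (show ¬ (v' < v + 1 ∧ g w = true) by omega)]
          split_ifs <;> norm_num
      have hm0 : (0 : ℝ) ≤ m * ∑ v' ∈ Finset.range v, φ g v' w := by positivity
      refine (sub_le_self _ hm0).trans ?_
      rw [← Finset.add_sum_erase _ _ (Finset.mem_range.2 hv)]
      refine le_add_of_le_of_nonneg (le_of_eq ?_) (Finset.sum_nonneg fun v' hv' =>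
        hterm v' (Finset.mem_of_mem_erase hv') (Finset.ne_of_mem_erase hv'))
      simp only [hfv, Nat.lt_succ_self, true_and]
  calc _ = ∑ g : Fin (cycleLen u) → Bool, ∑ w,
      ((if IsFirstRisky c a₁ f S g z v w then (3 / 4 - if g w = true then (1 : ℝ) else 0) else 0) -
        m * ∑ v' ∈ Finset.range v, φ g v' w) := by
        have e1 : ∀ g : Fin (cycleLen u) → Bool,
            ∑ v' ∈ Finset.range v, firstRiskyCount c a₁ f S v' g z =
              ∑ w, ∑ v' ∈ Finset.range v, φ g v' w := fun g => by
          rw [Finset.sum_comm]; rfl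
        have e2 : ∑ g : Fin (cycleLen u) → Bool, ∑ w, (if IsFirstRisky c a₁ f S g z v w then
            (3 / 4 - if g w = true then (1 : ℝ) else 0) else 0) =
            ∑ g : Fin (cycleLen u) → Bool, 1 / 4 * firstRiskyCount c a₁ f S v g z := by
          rw [Finset.sum_comm, ← Finset.mul_sum]
          unfold firstRiskyCount
          rw [Finset.sum_comm (s := (Finset.univ : Finset (Fin (cycleLen u) → Bool))),
            Finset.mul_sum]
          refine Finset.sum_congr rfl fun w _ => ?_
          have h := sum_isFirstRisky_bit c a₁ f (S := S) hz v w
          have h3 : ∑ g : Fin (cycleLen u) → Bool, (if IsFirstRisky c a₁ f S g z v w then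
              (3 / 4 - if g w = true then (1 : ℝ) else 0) else 0) =
              3 / 4 * ∑ g : Fin (cycleLen u) → Bool,
                (if IsFirstRisky c a₁ f S g z v w then (1 : ℝ) else 0) -
              ∑ g : Fin (cycleLen u) → Bool, (if IsFirstRisky c a₁ f S g z v w then
                (if g w = true then (1 : ℝ) else 0) else 0) := by
            rw [Finset.mul_sum, ← Finset.sum_sub_distrib]
            refine Finset.sum_congr rfl fun g _ => ?_
            split_ifs <;> norm_num
          rw [h3, h]
          ring
        simp only [Finset.sum_sub_distrib]
        rw [e2]
        congr 1
        refine Finset.sum_congr rfl fun g _ => ?_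
        rw [e1, Finset.mul_sum]
        simp [hm]
    _ ≤ _ := by
      refine Finset.sum_le_sum fun g _ => ?_
      rw [winRegret_const_eq c a₁ f hz]
      exact Finset.sum_le_sum fun w _ => hpos g w

open Classical in
/-- The policy that plays `a₂` on the target, and the safe action elsewhere. -/
noncomputable def targetPolicy (a₂ : A) (u : ℕ) (g : Fin (cycleLen u) → Bool) (x : 𝓧) : A :=
  if x ∈ c.target u g then a₂ else a₁

/-- If risky actions pay during the whole window, then on average over the bits, the regret with
respect to the policy of the target is large unless the rule makes risky plays at many
positions. -/
theorem sum_winRegret_targetPolicy_ge (hz : c.IsRegular z.1) {a₂ : A} (ha : a₁ ≠ a₂) :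
    ∑ g : Fin (cycleLen u) → Bool, (2 ^ u / 8 - 2 ^ winType u / 4 *
        ∑ v ∈ Finset.range (2 ^ winType u), firstRiskyCount c a₁ f S v g z) ≤
      ∑ g : Fin (cycleLen u) → Bool,
        winRegret f (schedReward c a₁ (S.set u (2 ^ winType u) g)) (targetPolicy c a₁ a₂ u g)
          u z := by
  classical
  set m := 2 ^ winType u with hm
  have hterm : ∀ g : Fin (cycleLen u) → Bool,
      ∑ w : Fin (cycleLen u), (m * (1 / 4 * if g w = true then (1 : ℝ) else 0) - m / 4 *
        ∑ v ∈ Finset.range m, if IsFirstRisky c a₁ f S g z v w then (1 : ℝ) else 0) ≤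
      winRegret f (schedReward c a₁ (S.set u m g)) (targetPolicy c a₁ a₂ u g) u z := by
    intro g
    rw [winRegret, sum_window, Finset.sum_comm]
    refine Finset.sum_le_sum fun w _ => ?_
    have hone : ∀ v ∈ Finset.range m, (1 / 4 * if g w = true then (1 : ℝ) else 0) - 1 / 4 *
        (∑ v' ∈ Finset.range m, if IsFirstRisky c a₁ f S g z v' w then (1 : ℝ) else 0) ≤
        ((schedReward c a₁ (S.set u m g)).reward (round u v w) (z.2.2 (round u v w))
          (targetPolicy c a₁ a₂ u g (z.1 (round u v w))) (z.1 (round u v w)) : ℝ) -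
        ((schedReward c a₁ (S.set u m g)).reward (round u v w) (z.2.2 (round u v w))
          (action f (schedReward c a₁ (S.set u m g)) z.2.1 z.1 z.2.2 (round u v w))
          (z.1 (round u v w)) : ℝ) := by
      intro v hv
      have hv := Finset.mem_range.1 hv
      rw [schedReward_some c a₁ _ _ _ _ (log_round hv w) (S.set_self m g),
        schedReward_some c a₁ _ _ _ _ (log_round hv w) (S.set_self m g), cycleIdx_round hv]
      unfold targetPolicy
      simp only [hz.mem_target_iff hv, hv, true_and]
      have hnn : (0 : ℝ) ≤ ∑ v' ∈ Finset.range m,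
          if IsFirstRisky c a₁ f S g z v' w then (1 : ℝ) else 0 :=
        Finset.sum_nonneg fun v' _ => by split_ifs <;> norm_num
      by_cases hr : IsRisky c a₁ f (S.set u m g) z (round u v w)
      · have hex : ∃ v', IsRisky c a₁ f (S.set u m g) z (round u v' w) := ⟨v, hr⟩
        have hf : IsFirstRisky c a₁ f S g z (Nat.find hex) w :=
          ⟨Nat.find_spec hex, fun v' hv' => Nat.find_min hex hv'⟩
        have hge : 1 ≤ ∑ v' ∈ Finset.range m,
            if IsFirstRisky c a₁ f S g z v' w then (1 : ℝ) else 0 := by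
          calc (1 : ℝ) = if IsFirstRisky c a₁ f S g z (Nat.find hex) w then (1 : ℝ) else 0 := by
                rw [if_pos hf]
            _ ≤ _ := Finset.single_le_sum
              (f := fun v' => if IsFirstRisky c a₁ f S g z v' w then (1 : ℝ) else 0)
              (fun v' _ => by split_ifs <;> norm_num)
              (Finset.mem_range.2 ((Nat.find_min' hex hr).trans_lt hv))
        unfold IsRisky at hr
        rw [if_neg hr]
        generalize (∑ v' ∈ Finset.range m,
          if IsFirstRisky c a₁ f S g z v' w then (1 : ℝ) else 0) = Q at *
        cases hgw : g w <;> simp [ha.symm] <;> linarith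
      · unfold IsRisky at hr
        rw [not_not] at hr
        rw [if_pos hr]
        generalize (∑ v' ∈ Finset.range m,
          if IsFirstRisky c a₁ f S g z v' w then (1 : ℝ) else 0) = Q at *
        cases hgw : g w <;> simp [ha.symm] <;> linarith
    calc _ = ∑ v ∈ Finset.range m, ((1 / 4 * if g w = true then (1 : ℝ) else 0) - 1 / 4 *
        (∑ v' ∈ Finset.range m, if IsFirstRisky c a₁ f S g z v' w then (1 : ℝ) else 0)) := by
          rw [Finset.sum_const, Finset.card_range, nsmul_eq_mul]; ring
      _ ≤ _ := Finset.sum_le_sum hone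
  refine le_trans (le_of_eq ?_) (Finset.sum_le_sum fun g _ => hterm g)
  simp only [Finset.sum_sub_distrib]
  congr 1
  · rw [Finset.sum_comm]
    simp only [← Finset.mul_sum, sum_bit]
    rw [Finset.sum_const, Finset.sum_const, Finset.card_univ, Finset.card_univ, Fintype.card_fin,
      nsmul_eq_mul, nsmul_eq_mul, show (2 : ℝ) ^ u = 2 ^ winType u * cycleLen u by
        exact_mod_cast (two_pow_winType_mul_cycleLen u).symm]
    push_cast [hm]
    ring
  · refine Finset.sum_congr rfl fun g _ => ?_
    rw [← Finset.mul_sum, Finset.sum_comm]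
    simp [hm, firstRiskyCount]

end Game

/-! ### The alternative for a single window -/

/-- A discrete Gronwall inequality. -/
theorem sum_le_of_le_add_sum {a : ℕ → ℝ} {b : ℝ} {m : ℕ} (hb : 0 ≤ b)
    (h : ∀ v < m, 1 / 4 * a v ≤ b + m * ∑ v' ∈ Finset.range v, a v') :
    ∑ v ∈ Finset.range m, a v ≤ 4 * b * m * (1 + 4 * m) ^ m := by
  suffices hk : ∀ k ≤ m, ∑ v ∈ Finset.range k, a v ≤ 4 * b * k * (1 + 4 * m) ^ k from hk m le_rfl
  intro k
  induction k with
  | zero => simp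
  | succ k ih =>
    intro hk
    have h1 := ih (by omega)
    have h2 := h k (by omega)
    rw [Finset.sum_range_succ]
    have hm : (0 : ℝ) ≤ m := Nat.cast_nonneg m
    have hp : (1 : ℝ) ≤ (1 + 4 * (m : ℝ)) ^ (k + 1) := one_le_pow₀ (by linarith)
    have h3 : (1 + 4 * (m : ℝ)) * ∑ v ∈ Finset.range k, a v ≤
        (1 + 4 * m) * (4 * b * k * (1 + 4 * m) ^ k) :=
      mul_le_mul_of_nonneg_left h1 (by linarith)
    have h4 : 4 * b ≤ 4 * b * (1 + 4 * (m : ℝ)) ^ (k + 1) := le_mul_of_one_le_right (by linarith) hp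
    have h5 : (1 + 4 * (m : ℝ)) * (4 * b * k * (1 + 4 * m) ^ k) =
        4 * b * k * (1 + 4 * m) ^ (k + 1) := by ring
    push_cast
    linarith

/-- The regret rate that can be enforced in windows of type `i` against a rule that plays risky
actions at many positions. The constant is the one for which `sum_le_of_le_add_sum` bounds the
mean number of such positions by a quarter of the length of a cycle. -/
noncomputable def riskRate (i : ℕ) : ℝ := 1 / (16 * (2 ^ i) ^ 2 * (1 + 4 * 2 ^ i) ^ 2 ^ i)

theorem riskRate_pos (i : ℕ) : 0 < riskRate i := by unfold riskRate; positivity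

section Alternative

variable {𝓧 : Type u} {A : Type v} [MeasurableSpace 𝓧] [MeasurableSpace A]
  {ν : Measure 𝓧} (c : CellSystem ν) {a₁ a₂ : A} (f : LearningRule.{u, v, w} 𝓧 A)
  {μ : ContextProcess 𝓧}

theorem measurable_targetPolicy (u : ℕ) (g : Fin (cycleLen u) → Bool) :
    Measurable (targetPolicy c a₁ a₂ u g) := by
  classical
  exact Measurable.ite (c.measurableSet_target u g) measurable_const measurable_const

theorem ae_runLaw_isRegular (hμ : ∀ᵐ x ∂(μ : Measure (ℕ → 𝓧)), c.IsRegular x) :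
    ∀ᵐ z ∂runLaw μ f, c.IsRegular z.1 :=
  Measure.quasiMeasurePreserving_fst.ae hμ

variable [MeasurableSingletonClass A]

theorem measurable_firstRiskyCount (S : Schedule) {u : ℕ} (v : ℕ) (g : Fin (cycleLen u) → Bool) :
    Measurable (firstRiskyCount c a₁ f S v g) := by
  classical
  have h : ∀ S t, MeasurableSet {z | IsRisky c a₁ f S z t} := fun S t =>
    (measurable_action_of_fixed f (schedReward c a₁ S) t (measurableSet_singleton a₁)).compl
  refine Finset.measurable_sum _ fun w _ => Measurable.ite ?_ measurable_const measurable_const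
  unfold IsFirstRisky
  have : {z | IsRisky c a₁ f (S.set u (2 ^ winType u) g) z (round u v w) ∧
      ∀ v' < v, ¬ IsRisky c a₁ f (S.set u (2 ^ winType u) g) z (round u v' w)} =
      {z | IsRisky c a₁ f (S.set u (2 ^ winType u) g) z (round u v w)} ∩
      ⋂ v', ⋂ _ : v' < v, {z | IsRisky c a₁ f (S.set u (2 ^ winType u) g) z (round u v' w)}ᶜ := by
    ext z; simp
  rw [this]
  exact (h _ _).inter (.iInter fun v' => .iInter fun _ => (h _ _).compl)

theorem integrable_firstRiskyCount (S : Schedule) {u : ℕ} (v : ℕ)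
    (g : Fin (cycleLen u) → Bool) :
    Integrable (firstRiskyCount c a₁ f S v g) (runLaw μ f) := by
  classical
  refine Integrable.of_bound (measurable_firstRiskyCount c f S v g).aestronglyMeasurable
    (cycleLen u) (ae_of_all _ fun z => ?_)
  unfold firstRiskyCount
  refine (norm_sum_le _ _).trans ((Finset.sum_le_sum (g := fun _ => (1 : ℝ)) fun w _ => ?_).trans
    (by simp))
  split_ifs <;> simp

/-- Either exploration can be made costly in comparison with the safe action, or there is a target
set which the rule fails to explore. Indeed, if exploration is cheap for every number of paying
cycles, then `sum_winRegret_const_ge` bounds the number of first risky plays in each cycle by the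
numbers for earlier cycles. By the Gronwall inequality there are few of them in the whole window,
and `sum_winRegret_targetPolicy_ge` applies. -/
theorem window_alternative (hμ : ∀ᵐ x ∂(μ : Measure (ℕ → 𝓧)), c.IsRegular x) (ha : a₁ ≠ a₂)
    (S : Schedule) (u : ℕ) :
    (∃ q g, riskRate (winType u) * 2 ^ u <
      ∫ z, winRegret f (schedReward c a₁ (S.set u q g)) (fun _ => a₁) u z ∂runLaw μ f) ∨
    ∃ g, 2 ^ u / 16 ≤ ∫ z, winRegret f (schedReward c a₁ (S.set u (2 ^ winType u) g))
      (targetPolicy c a₁ a₂ u g) u z ∂runLaw μ f := by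
  by_contra hcon
  push Not at hcon
  obtain ⟨hW, hV⟩ := hcon
  set m := 2 ^ winType u with hm
  set G : ℝ := ((Fintype.card (Fin (cycleLen u) → Bool) : ℕ) : ℝ) with hG
  have hG0 : 0 < G := Nat.cast_pos.2 Fintype.card_pos
  -- The mean number of first risky plays in cycle `v`, multiplied by the number of bit patterns.
  set a : ℕ → ℝ := fun v => ∑ g : Fin (cycleLen u) → Bool,
    ∫ z, firstRiskyCount c a₁ f S v g z ∂runLaw μ f with ha'
  have hreg := ae_runLaw_isRegular c f hμ
  have hF : ∀ v (g : Fin (cycleLen u) → Bool),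
      Integrable (firstRiskyCount c a₁ f S v g) (runLaw μ f) := fun v g =>
    integrable_firstRiskyCount c f S v g
  have hFs : ∀ (k : ℕ) (g : Fin (cycleLen u) → Bool), Integrable
      (fun z => ∑ v ∈ Finset.range k, firstRiskyCount c a₁ f S v g z) (runLaw μ f) := fun k g =>
    integrable_finsetSum _ fun v _ => hF v g
  have hrec : ∀ v < m, 1 / 4 * a v ≤ G * (riskRate (winType u) * 2 ^ u) +
      m * ∑ v' ∈ Finset.range v, a v' := by
    intro v hv
    have hD : ∀ g : Fin (cycleLen u) → Bool, Integrable (fun z =>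
        1 / 4 * firstRiskyCount c a₁ f S v g z -
          2 ^ winType u * ∑ v' ∈ Finset.range v, firstRiskyCount c a₁ f S v' g z) (runLaw μ f) :=
      fun g => ((hF v g).const_mul _).sub ((hFs v g).const_mul _)
    have h1 : ∫ z, ∑ g : Fin (cycleLen u) → Bool, (1 / 4 * firstRiskyCount c a₁ f S v g z -
        2 ^ winType u * ∑ v' ∈ Finset.range v, firstRiskyCount c a₁ f S v' g z) ∂runLaw μ f ≤
        ∫ z, ∑ g : Fin (cycleLen u) → Bool,
          winRegret f (schedReward c a₁ (S.set u (v + 1) g)) (fun _ => a₁) u z ∂runLaw μ f := by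
      refine integral_mono_ae (integrable_finsetSum _ fun g _ => hD g)
        (integrable_finsetSum _ fun g _ =>
          integrable_winRegret f _ μ measurable_const u) ?_
      filter_upwards [hreg] with z hz
      exact sum_winRegret_const_ge c a₁ f hz hv
    rw [integral_finsetSum _ fun g _ => hD g,
      integral_finsetSum _ fun g _ => integrable_winRegret f _ μ measurable_const u] at h1
    have h2 : ∑ g : Fin (cycleLen u) → Bool, ∫ z, winRegret f (schedReward c a₁
        (S.set u (v + 1) g)) (fun _ => a₁) u z ∂runLaw μ f ≤
        G * (riskRate (winType u) * 2 ^ u) := by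
      refine (Finset.sum_le_sum fun g _ => hW (v + 1) g).trans (le_of_eq ?_)
      rw [Finset.sum_const, nsmul_eq_mul, Finset.card_univ]
    have h3 : ∑ g : Fin (cycleLen u) → Bool, ∫ z, (1 / 4 * firstRiskyCount c a₁ f S v g z -
        2 ^ winType u * ∑ v' ∈ Finset.range v, firstRiskyCount c a₁ f S v' g z) ∂runLaw μ f =
        1 / 4 * a v - m * ∑ v' ∈ Finset.range v, a v' := by
      simp only [ha']
      rw [Finset.sum_comm, Finset.mul_sum, Finset.mul_sum, ← Finset.sum_sub_distrib]
      refine Finset.sum_congr rfl fun g _ => ?_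
      rw [integral_sub ((hF v g).const_mul _) ((hFs v g).const_mul _), integral_const_mul,
        integral_const_mul, integral_finsetSum _ fun v _ => hF v g]
      simp [hm]
    linarith
  have hgron := sum_le_of_le_add_sum (by have := riskRate_pos (winType u); positivity) hrec
  have hm0 : (0 : ℝ) < m := by rw [hm]; positivity
  have hmm : (m : ℝ) = 2 ^ winType u := by simp [hm]
  have hsum : ∑ v ∈ Finset.range m, a v ≤ G * 2 ^ u / (4 * m) := by
    refine hgron.trans (le_of_eq ?_)
    unfold riskRate
    rw [← hmm, ← hm]
    field_simp
    ring
  have hE : ∀ g : Fin (cycleLen u) → Bool, Integrable (fun z => 2 ^ u / 8 - 2 ^ winType u / 4 *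
      ∑ v ∈ Finset.range m, firstRiskyCount c a₁ f S v g z) (runLaw μ f) :=
    fun g => (integrable_const _).sub ((hFs m g).const_mul _)
  have h1 : ∫ z, ∑ g : Fin (cycleLen u) → Bool, (2 ^ u / 8 - 2 ^ winType u / 4 *
        ∑ v ∈ Finset.range m, firstRiskyCount c a₁ f S v g z) ∂runLaw μ f ≤
      ∫ z, ∑ g : Fin (cycleLen u) → Bool, winRegret f (schedReward c a₁ (S.set u m g))
        (targetPolicy c a₁ a₂ u g) u z ∂runLaw μ f := by
    refine integral_mono_ae (integrable_finsetSum _ fun g _ => hE g)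
      (integrable_finsetSum _ fun g _ =>
        integrable_winRegret f _ μ (measurable_targetPolicy c u g) u) ?_
    filter_upwards [hreg] with z hz
    exact sum_winRegret_targetPolicy_ge c a₁ f hz ha
  rw [integral_finsetSum _ fun g _ => hE g,
    integral_finsetSum _ fun g _ =>
      integrable_winRegret f _ μ (measurable_targetPolicy c u g) u] at h1
  have h2 : ∑ g : Fin (cycleLen u) → Bool, ∫ z, winRegret f (schedReward c a₁ (S.set u m g))
      (targetPolicy c a₁ a₂ u g) u z ∂runLaw μ f < G * (2 ^ u / 16) := by
    refine (Finset.sum_lt_sum_of_nonempty Finset.univ_nonempty fun g _ => hV g).trans_eq ?_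
    rw [Finset.sum_const, nsmul_eq_mul, Finset.card_univ]
  have h3 : ∑ g : Fin (cycleLen u) → Bool, ∫ z, (2 ^ u / 8 - 2 ^ winType u / 4 *
      ∑ v ∈ Finset.range m, firstRiskyCount c a₁ f S v g z) ∂runLaw μ f =
      G * (2 ^ u / 8) - m / 4 * ∑ v ∈ Finset.range m, a v := by
    simp only [ha']
    rw [Finset.sum_comm, Finset.mul_sum, hG, ← Finset.card_univ, ← nsmul_eq_mul,
      ← Finset.sum_const, ← Finset.sum_sub_distrib]
    refine Finset.sum_congr rfl fun g _ => ?_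
    rw [integral_sub (integrable_const _) ((hFs m g).const_mul _), integral_const_mul,
      integral_finsetSum _ fun v _ => hF v g]
    simp [hm]
  have h4 : (m : ℝ) / 4 * ∑ v ∈ Finset.range m, a v ≤ G * (2 ^ u / 16) := by
    refine (mul_le_mul_of_nonneg_left hsum (by positivity)).trans (le_of_eq ?_)
    field_simp
    norm_num
  linarith

end Alternative

/-! ### Limits of schedules -/

/-- Schedules can be constructed by successive extension, where stage `k` determines the windows
below some `N k` and `P k` is a property of these windows. -/
theorem exists_limit_schedule (P : ℕ → Schedule → ℕ → Prop) {S₀ : Schedule} {N₀ : ℕ}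
    (h0 : P 0 S₀ N₀)
    (hloc : ∀ k S S' N, (∀ u < N, S u = S' u) → P k S N → P k S' N)
    (hstep : ∀ k S N, P k S N → ∃ S' N', N < N' ∧ (∀ u < N, S' u = S u) ∧ P (k + 1) S' N') :
    ∃ (S : Schedule) (N : ℕ → ℕ), StrictMono N ∧ ∀ k, P k S (N k) := by
  choose! F G hG hF hP using hstep
  set seq : ℕ → Schedule × ℕ := fun k => Nat.rec (S₀, N₀) (fun k p => (F k p.1 p.2, G k p.1 p.2)) k
    with hseq
  have hs : ∀ k, seq (k + 1) = (F k (seq k).1 (seq k).2, G k (seq k).1 (seq k).2) := fun k => rfl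
  have hPk : ∀ k, P k (seq k).1 (seq k).2 := fun k => by
    induction k with
    | zero => exact h0
    | succ k ih => rw [hs]; exact hP k _ _ ih
  have hmono : StrictMono fun k => (seq k).2 := strictMono_nat_of_lt_succ fun k => by
    rw [hs]; exact hG k _ _ (hPk k)
  have hagree : ∀ j k u, u < (seq k).2 → (seq (k + j)).1 u = (seq k).1 u := by
    intro j k u hu
    induction j with
    | zero => rfl
    | succ j ih =>
      rw [← ih, ← add_assoc, hs]
      exact hF _ _ _ (hPk _) u (hu.trans_le (hmono.monotone (Nat.le_add_right k j)))
  refine ⟨fun u => (seq (u + 1)).1 u, fun k => (seq k).2, hmono, fun k => ?_⟩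
  refine hloc k _ _ _ (fun u hu => ?_) (hPk k)
  rcases le_total k (u + 1) with h | h
  · obtain ⟨j, hj⟩ := Nat.exists_eq_add_of_le h
    rw [hj]
    exact (hagree j k u hu).symm
  · obtain ⟨j, hj⟩ := Nat.exists_eq_add_of_le h
    rw [hj]
    exact hagree j (u + 1) u (Nat.lt_of_succ_le hmono.le_apply)

/-! ### The cyclic process is not learnable -/

section NotLearnable

variable {𝓧 : Type u} {A : Type v} [MeasurableSpace 𝓧] [MeasurableSpace A]
  [MeasurableSingletonClass A] {ν : Measure 𝓧} (c : CellSystem ν) {a₁ a₂ : A}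
  {f : LearningRule.{u, v, w} 𝓧 A} {μ : ContextProcess 𝓧}

/-- A schedule that vanishes from window `N` on. -/
def Schedule.truncate (S : Schedule) (N : ℕ) : Schedule := fun u => if u < N then S u else none

/-- A consistent rule fails to explore some target set in some window of any given type that is
preceded by at least ten windows without rewards, where the schedule below window `N` can be
prescribed. Otherwise `window_alternative` provides arbitrarily late windows with a regret rate of
at least `riskRate i` with respect to the safe action. They can be combined to one schedule in which
the expected average regret has a positive limit superior. -/
theorem exists_unexplored_window (hf : ∀ R, IsConsistent μ R f)
    (hμ : ∀ᵐ x ∂(μ : Measure (ℕ → 𝓧)), c.IsRegular x) (ha : a₁ ≠ a₂) (S : Schedule) (N i : ℕ) :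
    ∃ (S' : Schedule) (u : ℕ) (g : Fin (cycleLen u) → Bool), N + 10 ≤ u ∧ winType u = i ∧
      (∀ w < N, S' w = S w) ∧ (∀ w, u < w + 11 → w < u → S' w = none) ∧
      2 ^ u / 16 ≤ ∫ z, winRegret f (schedReward c a₁ S') (targetPolicy c a₁ a₂ u g) u z
        ∂runLaw μ f := by
  by_contra hcon
  push Not at hcon
  set W : Schedule → ℕ → ℝ := fun S u =>
    ∫ z, winRegret f (schedReward c a₁ S) (fun _ => a₁) u z ∂runLaw μ f with hW
  have hWloc : ∀ (S S' : Schedule) U, (∀ w < U, S w = S' w) → ∀ u < U, W S u = W S' u :=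
    fun S S' U h u hu => integral_congr_ae (ae_of_all _ fun z =>
      winRegret_schedReward_congr f c a₁ h hu _ z)
  -- As long as the conclusion fails, windows with high expected regret can be appended.
  obtain ⟨T, M, hM, hT⟩ := exists_limit_schedule
    (fun k S' M => N ≤ M ∧ (∀ w < N, S' w = S w) ∧ (∀ w, N ≤ w → w < M → 0 ≤ W S' w) ∧
      (0 < k → ∃ u, M = u + 1 ∧ riskRate i * 2 ^ u ≤ W S' u))
    (S₀ := S) (N₀ := N)
    ⟨le_rfl, fun _ _ => rfl, fun w h h' => absurd h (not_le.2 h'), fun h => absurd h (lt_irrefl 0)⟩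
    (by
      rintro k S₁ S₂ M h ⟨h1, h2, h3, h4⟩
      refine ⟨h1, fun w hw => (h w (hw.trans_le h1)).symm.trans (h2 w hw), fun w hw hw' => ?_,
        fun hk => ?_⟩
      · rw [← hWloc S₁ S₂ M h w hw']; exact h3 w hw hw'
      · obtain ⟨u, rfl, hu⟩ := h4 hk
        exact ⟨u, rfl, by rwa [← hWloc S₁ S₂ _ h u (Nat.lt_succ_self u)]⟩)
    (by
      rintro k S₁ M ⟨h1, h2, h3, -⟩
      obtain ⟨u, hu, hui⟩ := exists_le_winType_eq i (M + 11)
      have hlow : ∀ q g, ∀ w < M, (S₁.truncate M).set u q g w = S₁ w := fun q g w hw => by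
        rw [Schedule.set_of_ne _ (by omega)]
        exact if_pos hw
      have hmid : ∀ q g w, M ≤ w → w < u → (S₁.truncate M).set u q g w = none :=
        fun q g w hw hw' => by
          rw [Schedule.set_of_ne _ hw'.ne]
          exact if_neg (not_lt.2 hw)
      rcases window_alternative c f hμ ha (S₁.truncate M) u with ⟨q, g, h⟩ | ⟨g, h⟩
      · refine ⟨(S₁.truncate M).set u q g, u + 1, by omega, hlow q g, by omega,
          fun w hw => (hlow q g w (by omega)).trans (h2 w hw), fun w hw hw' => ?_,
          fun _ => ⟨u, rfl, ?_⟩⟩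
        · rcases Nat.lt_or_ge w M with hwM | hwM
          · rw [hWloc _ S₁ M (hlow q g) w hwM]; exact h3 w hw hwM
          · rcases Nat.lt_or_ge w u with hwu | hwu
            · refine le_of_eq (Eq.symm ?_)
              simp only [hW]
              rw [integral_congr_ae (ae_of_all _ fun z =>
                winRegret_schedReward_none f c a₁ (hmid q g w hwM hwu) _ z)]
              simp
            · obtain rfl : w = u := by omega
              exact (mul_nonneg (riskRate_pos _).le (by positivity)).trans h.le
        · rw [← hui]; exact h.le
      · refine absurd h (not_le.2 (hcon _ u g (by omega) hui (fun w hw => ?_) fun w hw hw' => ?_))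
        · exact (hlow _ g w (by omega)).trans (h2 w hw)
        · exact hmid _ g w (by omega) hw')
  have hε := riskRate_pos i
  -- Beyond window `N` regret is nonnegative, and at the end of an appended window `u` its average
  -- is at least `(riskRate i * 2 ^ u - 2 ^ N) / 2 ^ (u + 1) > riskRate i / 8`.
  have hev := (hf (schedReward c a₁ T)).eventually_integral_avgRegret_le
    (measurable_const (a := a₁)) (show 0 < riskRate i / 8 by linarith)
  obtain ⟨T₀, hT₀⟩ := eventually_atTop.1 hev
  obtain ⟨k₀, hk₀⟩ := exists_nat_ge (2 ^ N / (riskRate i / 4))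
  obtain ⟨k, hkT, hkk, hk1⟩ : ∃ k, T₀ ≤ k ∧ k₀ ≤ k ∧ 1 ≤ k :=
    ⟨max (max T₀ k₀) 1, by omega, by omega, by omega⟩
  obtain ⟨h1, -, h3, h4⟩ := hT k
  obtain ⟨u, hu, hWu⟩ := h4 (by omega)
  have hku : k ≤ u + 1 := hu ▸ hM.le_apply
  have hkpow : k ≤ 2 ^ u := hku.trans Nat.lt_two_pow_self
  have hNu : N ≤ u := by
    by_contra h
    have h' : u + 1 = N := by omega
    have : N < u + 1 := by
      have := hM (show 0 < k by omega)
      have h0 := (hT 0).1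
      omega
    omega
  have hle := hT₀ (2 ^ (u + 1) - 1) (by rw [pow_succ]; omega)
  rw [integral_avgRegret f _ μ measurable_const] at hle
  have hsplit : ∑ w ∈ Finset.range (u + 1), W T w ≥ riskRate i * 2 ^ u - 2 ^ N := by
    rw [Finset.sum_range_succ, ← Finset.sum_range_add_sum_Ico _ hNu]
    have e1 : -(2 : ℝ) ^ N ≤ ∑ w ∈ Finset.range N, W T w := by
      have : ∑ w ∈ Finset.range N, (-2 ^ w : ℝ) ≤ ∑ w ∈ Finset.range N, W T w :=
        Finset.sum_le_sum fun w _ => neg_le_integral_winRegret f _ μ measurable_const w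
      rw [Finset.sum_neg_distrib, geom_sum_eq (by norm_num)] at this
      linarith
    have e2 : 0 ≤ ∑ w ∈ Finset.Ico N u, W T w := Finset.sum_nonneg fun w hw =>
      h3 w (Finset.mem_Ico.1 hw).1 (by have := (Finset.mem_Ico.1 hw).2; omega)
    linarith
  have hN2 : (2 : ℝ) ^ N ≤ riskRate i / 4 * 2 ^ u := by
    have e1 : (k₀ : ℝ) ≤ 2 ^ u := by exact_mod_cast (by omega : k₀ ≤ 2 ^ u)
    have e2 := hk₀.trans e1
    rw [div_le_iff₀ (by linarith)] at e2
    linarith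
  have hTpos : (0 : ℝ) < ((2 ^ (u + 1) - 1 : ℕ) : ℝ) := by
    have : 0 < 2 ^ (u + 1) - 1 := by
      have : 0 < 2 ^ u := by positivity
      rw [pow_succ]; omega
    exact_mod_cast this
  have hTle : ((2 ^ (u + 1) - 1 : ℕ) : ℝ) ≤ 2 * 2 ^ u := by
    have : 2 ^ (u + 1) - 1 ≤ 2 * 2 ^ u := by rw [pow_succ]; omega
    exact_mod_cast this
  rw [one_div, inv_mul_le_iff₀ hTpos] at hle
  have h2u : (0 : ℝ) < 2 ^ u := by positivity
  have hprod : ((2 ^ (u + 1) - 1 : ℕ) : ℝ) * (riskRate i / 8) ≤ 2 * 2 ^ u * (riskRate i / 8) :=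
    mul_le_mul_of_nonneg_right hTle (by linarith)
  have hmul : 0 < riskRate i * 2 ^ u := mul_pos hε h2u
  change ∑ w ∈ Finset.range (u + 1), W T w ≤ _ at hle
  nlinarith

/-- A schedule is built from windows of every type in which the rule fails to explore a target. The
policy for the union of the targets is as good as the policy of the target in each of these windows,
because windows of different types use disjoint blocks. The windows before the last one contribute
little, because they are short or have no rewards. -/
theorem notMem_COblivious (hμ : ∀ᵐ x ∂(μ : Measure (ℕ → 𝓧)), c.IsRegular x)
    (hA : ∃ a₁ a₂ : A, a₁ ≠ a₂) : μ ∉ COblivious.{u, v, w} 𝓧 A := by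
  classical
  rintro ⟨f, hf⟩
  obtain ⟨a₁, a₂, ha⟩ := hA
  set V : Schedule → (u : ℕ) → (Fin (cycleLen u) → Bool) → ℝ := fun S u g =>
    ∫ z, winRegret f (schedReward c a₁ S) (targetPolicy c a₁ a₂ u g) u z ∂runLaw μ f with hV
  obtain ⟨T, M, hM, hT⟩ := exists_limit_schedule
    (fun k S' M => 0 < k → ∃ u g, M = u + 1 ∧ 10 ≤ u ∧ winType u = k - 1 ∧
      (∀ w, u < w + 11 → w < u → S' w = none) ∧ 2 ^ u / 16 ≤ V S' u g)
    (S₀ := fun _ => none) (N₀ := 0) (fun h => absurd h (lt_irrefl 0))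
    (by
      intro k S₁ S₂ M h hP hk
      obtain ⟨u, g, rfl, h1, h2, h3, h4⟩ := hP hk
      refine ⟨u, g, rfl, h1, h2, fun w hw hw' => (h w (by omega)).symm.trans (h3 w hw hw'), ?_⟩
      refine h4.trans (le_of_eq (integral_congr_ae (ae_of_all _ fun z => ?_)))
      exact winRegret_schedReward_congr f c a₁ h (Nat.lt_succ_self u) _ z)
    (by
      intro k S₁ M _
      obtain ⟨S', u, g, h1, h2, h3, h4, h5⟩ := exists_unexplored_window c hf hμ ha S₁ M k
      exact ⟨S', u + 1, by omega, h3, fun _ => ⟨u, g, rfl, by omega, h2, h4, h5⟩⟩)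
  have hT' := fun k => hT (k + 1) (Nat.succ_pos k)
  choose U g hMU hU hUt hnone hreg using hT'
  set G : Set 𝓧 := ⋃ k, c.target (U k) (g k) with hG
  have hGm : MeasurableSet G := .iUnion fun k => c.measurableSet_target _ _
  set π : 𝓧 → A := fun x => if x ∈ G then a₂ else a₁ with hπ
  have hπm : Measurable π := Measurable.ite hGm measurable_const measurable_const
  -- At the end of window `u` the average regret will be at least
  -- `(2 ^ u / 16 - 2 ^ (u - 10)) / 2 ^ (u + 1) > 1 / 100`.
  have hev := (hf (schedReward c a₁ T)).eventually_integral_avgRegret_le hπm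
    (show (0 : ℝ) < 1 / 100 by norm_num)
  obtain ⟨T₀, hT₀⟩ := eventually_atTop.1 hev
  set u := U T₀ with hu
  have hTu : T₀ ≤ u := by
    have := hM.le_apply (x := T₀ + 1)
    have := hMU T₀
    omega
  have hle := hT₀ (2 ^ (u + 1) - 1) (by
    have := Nat.lt_two_pow_self (n := u)
    rw [pow_succ]; omega)
  rw [integral_avgRegret f _ μ hπm] at hle
  -- In window `u` the policy `π` agrees with the policy of the target.
  have hlast : 2 ^ u / 16 ≤ ∫ z, winRegret f (schedReward c a₁ T) π u z ∂runLaw μ f := by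
    refine (hreg T₀).trans (le_of_eq (integral_congr_ae ?_))
    filter_upwards [ae_runLaw_isRegular c f hμ] with z hz
    unfold winRegret
    refine Finset.sum_congr rfl fun t ht => ?_
    have hmem : z.1 t ∈ c.block T₀ := by
      have h1 := hz t
      rw [mem_window.1 ht] at h1
      have h2 := c.cell_subset u _ (CellSystem.cyclePos_lt_of_log_eq (mem_window.1 ht)) h1
      rwa [hu, hUt T₀, Nat.add_sub_cancel] at h2
    have hiff : z.1 t ∈ G ↔ z.1 t ∈ c.target u (g T₀) := by
      refine ⟨fun h => ?_, fun h => Set.mem_iUnion.2 ⟨T₀, h⟩⟩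
      obtain ⟨k, hk⟩ := Set.mem_iUnion.1 h
      have h2 := c.target_subset_block _ _ hk
      rw [hUt k, Nat.add_sub_cancel] at h2
      have : k = T₀ := by
        by_contra hne
        exact Set.disjoint_left.1 (c.disjoint_block hne) h2 hmem
      subst this
      exact hk
    have hpol : π (z.1 t) = targetPolicy c a₁ a₂ u (g T₀) (z.1 t) := by
      simp only [hπ, targetPolicy, hiff]
    rw [hpol]
  -- Windows below `u - 10` have length less than `2 ^ (u - 10)` in total, the others no rewards.
  have hbefore : -(2 : ℝ) ^ (u - 10) ≤
      ∑ w ∈ Finset.range u, ∫ z, winRegret f (schedReward c a₁ T) π w z ∂runLaw μ f := by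
    have h1 : ∑ w ∈ Finset.range u, (if w < u - 10 then (-2 ^ w : ℝ) else 0) ≤
        ∑ w ∈ Finset.range u, ∫ z, winRegret f (schedReward c a₁ T) π w z ∂runLaw μ f := by
      refine Finset.sum_le_sum fun w hw => ?_
      split_ifs with h
      · exact neg_le_integral_winRegret f _ μ hπm w
      · refine le_of_eq (Eq.symm ?_)
        rw [integral_congr_ae (ae_of_all _ fun z => winRegret_schedReward_none f c a₁
          (hnone T₀ w (by omega) (Finset.mem_range.1 hw)) _ z)]
        simp
    have h2 : ∑ w ∈ Finset.range u, (if w < u - 10 then (-2 ^ w : ℝ) else 0) =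
        ∑ w ∈ Finset.range (u - 10), (-2 ^ w : ℝ) := by
      rw [← Finset.sum_filter]
      refine Finset.sum_congr (Finset.ext fun w => ?_) fun _ _ => rfl
      simp only [Finset.mem_filter, Finset.mem_range]
      omega
    rw [h2, Finset.sum_neg_distrib, geom_sum_eq (by norm_num)] at h1
    linarith
  have hpow : (2 : ℝ) ^ (u - 10) * 1024 = 2 ^ u := by
    rw [show (1024 : ℝ) = 2 ^ 10 by norm_num, ← pow_add, Nat.sub_add_cancel (hU T₀)]
  have hTpos : (0 : ℝ) < ((2 ^ (u + 1) - 1 : ℕ) : ℝ) := by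
    have : 0 < 2 ^ (u + 1) - 1 := by
      have : 0 < 2 ^ u := by positivity
      rw [pow_succ]; omega
    exact_mod_cast this
  have hTle : ((2 ^ (u + 1) - 1 : ℕ) : ℝ) ≤ 2 * 2 ^ u := by
    have : 2 ^ (u + 1) - 1 ≤ 2 * 2 ^ u := by rw [pow_succ]; omega
    exact_mod_cast this
  rw [one_div, inv_mul_le_iff₀ hTpos, Finset.sum_range_succ] at hle
  have h2u : (0 : ℝ) < 2 ^ u := by positivity
  linarith

end NotLearnable

end ContextualBandit

theorem mainTheorem3 {𝓧 : Type u} [TopologicalSpace 𝓧] [TopologicalSpace.MetrizableSpace 𝓧]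
    [TopologicalSpace.SeparableSpace 𝓧] [MeasurableSpace 𝓧] [BorelSpace 𝓧]
    {A : Type v} [TopologicalSpace A] [TopologicalSpace.MetrizableSpace A]
    [TopologicalSpace.SeparableSpace A] [MeasurableSpace A] [BorelSpace A]
    (hX : ∃ ν : Measure 𝓧, IsProbabilityMeasure ν ∧ ∀ x : 𝓧, ν {x} = 0)
    (hA : ∃ a₁ a₂ : A, a₁ ≠ a₂) :
    ContextualBandit.C4 𝓧 ⊂ ContextualBandit.C2 𝓧 ∧
      ContextualBandit.COblivious.{u, v, w} 𝓧 A ⊂ ContextualBandit.C2 𝓧 := by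
  obtain ⟨ν, hν, hν0⟩ := hX
  obtain ⟨c⟩ := ContextualBandit.nonempty_cellSystem ν hν0
  exact ⟨(Set.ssubset_iff_of_subset (ContextualBandit.C4_subset_C2 𝓧)).2
      ⟨c.process, c.process_mem_C2, c.process_notMem_C4⟩,
    (Set.ssubset_iff_of_subset (ContextualBandit.COblivious_subset_C2 hA)).2
      ⟨c.process, c.process_mem_C2,
        ContextualBandit.notMem_COblivious c c.ae_process_mem_cell hA⟩⟩
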